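/- Let $\mathbb{C}P^n=S^{2n+1}/S^1$ carry the Fubini–Study metric induced from the unit sphere, with complex structure $J$. Represent a tangent vector at $[\zeta]$ by a pair $(\zeta,\xi)$ with $\zeta\in\mathbb{C}^{n+1}\setminus\{0\}$ and $\xi\cdot\bar\zeta=0$, modulo $(\zeta,\xi)\sim(\lambda\zeta,\lambda\xi)$ for $\lambda\in\mathbb{C}^*$, where the dot denotes the $\mathbb{C}$-bilinear product. Identify $T\mathbb{C}P^n$ with $\mathcal M=\{([z],[w])\in\mathbb{C}P^n\times\mathbb{C}P^n : z\cdot w\neq 0\}$ by $$\Phi[\zeta,\xi]=\left(\left[\cosh\mu\,\zeta+i\tfrac{\sinh\mu}{\mu}\xi\right],\left[\cosh\mu\,\bar\zeta+i\tfrac{\sinh\mu}{\mu}\bar\xi\right]\right),\qquad \mu=|\xi|/|\zeta|,$$ where $\frac{\sinh\mu}{\mu}$ is read as $1$ at $\mu=0$. On $\mathcal M$ consider the Stenzel Kähler form $\Omega=i\partial\bar\partial f$ with potential $f=2\sqrt{\mathcal N}$, $\mathcal N=|z|^2|w|^2/|z\cdot w|^2$, and the holomorphic volume form $\Theta$ given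 in the affine coordinates $Z_a=z_a/z_0$, $W_a=w_a/w_0$ by $$\Theta=2^n\Bigl(1+\sum_a Z_aW_a\Bigr)^{-(n+1)}dZ_1\wedge\dots\wedge dZ_n\wedge dW_1\wedge\dots\wedge dW_n .$$ Let $M$ be a smoothly immersed submanifold of $\mathbb{C}P^n$ of real dimension $k$, with normal bundle $NM\subset T\mathbb{C}P^n$. Call $M$ *austere* if $NM$ is special Lagrangian with respect to this structure with some constant phase, that is, if there is a constant $\varphi\in\mathbb{R}$ such that $\Omega$ and $\operatorname{Im}(e^{i\varphi}\Theta)$ both vanish on all tangent spaces of $\Phi(NM)$. **Theorem.** $M$ is austere if and only if for every point $p\in M$ and every unit normal vector $\nu\in N_pM$, $$H^{(2j+1)}=\cos^2\theta\;\hat H^{(2j-1)},\qquad 0\le j\le\lfloor k/2\rfloor .$$ Here $\theta$ is the angle between $J\nu$ and $T_pM$ (equal to $\pi/2$ if $J\nu\perp T_pM$), $H=\nu\cdot\mathrm{II}$ is the second fundamental form of $M$ in the direction $\nu$, $\hat H$ is the restriction of $H$ to the subspace $\{X\in T_pM : X\perp J\nu\}$, and $H^{(d)}$, $\hat H^{(d)}$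 denote the elementary symmetric polynomials of degree $d$ in the eigenvalues of the symmetric matrices representing these forms in orthonormal bases. They are understood to be zero if $d$ is negative or larger than the size of the matrix. -/

import Mathlib

open scoped Manifold ContDiff InnerProductSpace Topology

noncomputable section

namespace CPAustere

/-- The space `ℂ^{n+1}` of homogeneous coordinates, with its standard Hermitian product. Its real
part is `inner ℝ`, and the complex structure `J` is multiplication by `Complex.I`. -/
abbrev Hom (n : ℕ) : Type := EuclideanSpace ℂ (Fin (n + 1))

/-- `ℝ^k`, the model space of a `k`-dimensional manifold. -/
abbrev Coord (k : ℕ) : Type := EuclideanSpace ℝ (Fin k)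

/-! ### Maps into complex projective space

A map into `ℂP^n` is described by its local lifts through the Hopf fibration
`π : S^{2n+1} → ℂP^n`. The metric on `ℂP^n` is the one for which `π` is a Riemannian submersion.
A tangent vector of `ℂP^n` at `[ζ]`, with `‖ζ‖ = 1`, is represented by its horizontal lift at `ζ`,
a vector `ξ` with `⟪ζ, ξ⟫_ℂ = 0`; the pairs `(ζ, ξ)` and `(λ ζ, λ ξ)` with `|λ| = 1` represent
the same tangent vector. -/

variable {n k : ℕ}

/-- The coordinate vector of `p` in the preferred chart of `M` at `p`. -/
def chartPt (k : ℕ) {M : Type*} [TopologicalSpace M] [ChartedSpace (Coord k) M] (p : M) :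
    Coord k :=
  extChartAt (𝓡 k) p p

/-- `z` is a smooth local lift of `F : M → ℂP^n` to the unit sphere `S^{2n+1}`, written in the
preferred chart of `M` at `p`, and defined near `p`. -/
def IsLiftAt {M : Type*} [TopologicalSpace M] [ChartedSpace (Coord k) M]
    (F : M → Projectivization ℂ (Hom n)) (p : M) (z : Coord k → Hom n) : Prop :=
  ∃ U : Set (Coord k), IsOpen U ∧ chartPt k p ∈ U ∧ ContDiffOn ℝ ∞ z U ∧
    ∀ x ∈ U, ‖z x‖ = 1 ∧ z x ∈ (F ((extChartAt (𝓡 k) p).symm x)).submodule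

/-- The projection of `ℂ^{n+1}` onto the Hermitian complement of `ζ` (at `‖ζ‖ = 1`: the
horizontal part of a vector). -/
def hproj (ζ : Hom n) : Hom n →L[ℝ] Hom n :=
  ((ℂ ∙ ζ)ᗮ.starProjection).restrictScalars ℝ

/-- The differential of `π ∘ z` at `x`, as a map into the horizontal space at `z x`. -/
def hderiv (z : Coord k → Hom n) (x : Coord k) : Coord k →L[ℝ] Hom n :=
  (hproj (z x)).comp (fderiv ℝ z x)

/-- `F : M → ℂP^n` is a smooth immersion, i.e. `M` is an immersed submanifold of `ℂP^n`. -/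
def IsSmoothImmersion (k : ℕ) {M : Type*} [TopologicalSpace M] [ChartedSpace (Coord k) M]
    (F : M → Projectivization ℂ (Hom n)) : Prop :=
  ∀ p : M, ∃ z : Coord k → Hom n, IsLiftAt F p z ∧ Function.Injective (hderiv z (chartPt k p))

/-- The tangent space of the immersed submanifold at the point with coordinates `x`, as a real
subspace of the horizontal space at `z x`. -/
def tangentSubspace (z : Coord k → Hom n) (x : Coord k) : Submodule ℝ (Hom n) :=
  LinearMap.range (hderiv z x).toLinearMap

/-- `ν` is (the horizontal lift at `z x` of) a normal vector of the submanifold. -/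
def IsNormal (z : Coord k → Hom n) (x : Coord k) (ν : Hom n) : Prop :=
  ⟪z x, ν⟫_ℂ = 0 ∧ ∀ X ∈ tangentSubspace z x, ⟪X, ν⟫_ℝ = 0

/-- The Levi-Civita covariant derivative `∇_u Y` at `x` of a vector field `Y` of `ℂP^n` along
the map `π ∘ z`, where `Y y` is the horizontal lift at `z y`. The second term compensates for the
vertical part of the derivative of the lift `z`, so that `∇_u Y` does not depend on the lift. -/
def covDeriv (z Y : Coord k → Hom n) (x u : Coord k) : Hom n :=
  hproj (z x) (fderiv ℝ Y x u) - ⟪z x, fderiv ℝ z x u⟫_ℂ • Y x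

/-- `ν · II(u, v)`: the second fundamental form in the normal direction `ν`, evaluated on the
tangent vectors with coordinates `u` and `v` (`v` is extended with constant coordinates). -/
def secondFF (z : Coord k → Hom n) (x : Coord k) (ν : Hom n) (u v : Coord k) : ℝ :=
  ⟪covDeriv z (fun y => hderiv z y v) x u, ν⟫_ℝ

/-- The matrix of `ν · II` on the vectors with coordinates `e 1, …, e m`. -/
def secondFFMatrix (z : Coord k → Hom n) (x : Coord k) (ν : Hom n) {m : ℕ}
    (e : Fin m → Coord k) : Matrix (Fin m) (Fin m) ℝ :=
  Matrix.of fun a b => secondFF z x ν (e a) (e b)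

/-- `e` represents an orthonormal basis of the subspace `W` of the tangent space. -/
def IsONBasis (z : Coord k → Hom n) (x : Coord k) (W : Submodule ℝ (Hom n)) {m : ℕ}
    (e : Fin m → Coord k) : Prop :=
  Orthonormal ℝ (fun a => hderiv z x (e a)) ∧
    Submodule.span ℝ (Set.range fun a => hderiv z x (e a)) = W

/-- The elementary symmetric polynomial of degree `d` in the eigenvalues (with multiplicity) of a
real symmetric matrix; it is zero if `d` is negative or larger than the size of the matrix. -/
def elemSymm {m : ℕ} (A : Matrix (Fin m) (Fin m) ℝ) (d : ℤ) : ℝ :=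
  if d < 0 then 0 else A.charpoly.roots.esymm d.toNat

/-- The vector `J ν`. -/
def J (ν : Hom n) : Hom n := Complex.I • ν

/-- The angle between a vector `w` and a real subspace `T`. It is `π / 2` if `w` is orthogonal
to `T`. -/
def angleTo (w : Hom n) (T : Submodule ℝ (Hom n)) : ℝ :=
  InnerProductGeometry.angle w (T.starProjection w)

/-! ### The Stenzel structure

`TℂP^n` is identified with the set `𝓜` of those `([z], [w])` in `ℂP^n × ℂP^n` with
`∑ z_j w_j ≠ 0`. Functions and forms on `𝓜` are represented by their pull-backs to
`{(z, w) ∈ ℂ^{n+1} × ℂ^{n+1} | ∑ z_j w_j ≠ 0}`. -/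

/-- Pairs of vectors of homogeneous coordinates. -/
abbrev Pair (n : ℕ) : Type := Hom n × Hom n

/-- The complex conjugate of a vector. -/
def conjVec (v : Hom n) : Hom n := WithLp.toLp 2 fun i => (starRingEnd ℂ) (v i)

/-- The map `(ζ, ξ) ↦ (cosh μ ζ + i (sinh μ / μ) ξ ; cosh μ ζ̄ + i (sinh μ / μ) ξ̄)`, where
`μ = |ξ| / |ζ|`, which covers the identification `Φ` of `TℂP^n` with `𝓜`. (Where `μ = 0` also
`ξ = 0`, and the value of `sinh μ / μ` does not matter.) -/
def PhiHat (ζ ξ : Hom n) : Pair n :=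
  let μ : ℝ := ‖ξ‖ / ‖ζ‖
  let c : ℂ := (Real.cosh μ : ℂ)
  let s : ℂ := Complex.I * ((Real.sinh μ / μ : ℝ) : ℂ)
  (c • ζ + s • ξ, c • conjVec ζ + s • conjVec ξ)

/-- The `ℂ`-bilinear product `∑ z_j w_j`. -/
def bdot (q : Pair n) : ℂ := ∑ j, q.1 j * q.2 j

/-- The exhaustion function `𝓝 = (∑_{j,k} |z_j w_k|²) / |∑ z_j w_j|²` of `𝓜`. -/
def exhaustion (q : Pair n) : ℝ :=
  (∑ j, ∑ l, ‖q.1 j * q.2 l‖ ^ 2) / ‖bdot q‖ ^ 2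

/-- The Kähler potential `f(𝓝)` of the Stenzel metric, with `f' = 𝓝 ^ (-1/2)`. -/
def potential (q : Pair n) : ℝ := 2 * Real.sqrt (exhaustion q)

/-- The Kähler form `Ω = i ∂∂̄ f` of the Stenzel metric: for a real function `f` one has
`(i ∂∂̄ f)(u, v) = (D²f(iu, v) - D²f(u, iv)) / 2`. -/
def stenzelForm (q u v : Pair n) : ℝ :=
  (fderiv ℝ (fderiv ℝ potential) q (Complex.I • u) v
    - fderiv ℝ (fderiv ℝ potential) q u (Complex.I • v)) / 2

/-- The coordinates of a pair of vectors. -/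
def pairCoords (v : Pair n) : Fin (n + 1) ⊕ Fin (n + 1) → ℂ :=
  Sum.elim (fun i => v.1 i) (fun i => v.2 i)

/-- The holomorphic volume form `Θ` of `𝓜`. In the affine coordinates `Z_a = z_a / z_0`,
`W_a = w_a / w_0` it is `2^n (1 + ∑ Z_a W_a)^{-(n+1)} dZ_1 ∧ ⋯ ∧ dZ_n ∧ dW_1 ∧ ⋯ ∧ dW_n`. It is
the holomorphic volume form which is parallel for the Stenzel metric, normalised so that `|Θ|` is
the Riemannian volume on Lagrangian tangent spaces. -/
def holVol (q : Pair n) (v : Fin n ⊕ Fin n → Pair n) : ℂ :=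
  2 ^ n *
    Matrix.det (Matrix.of (Sum.elim
      (Fin.cons (pairCoords ((q.1, 0) : Pair n)) fun a : Fin n => pairCoords (v (Sum.inl a)))
      (Fin.cons (pairCoords ((0, q.2) : Pair n)) fun a : Fin n => pairCoords (v (Sum.inr a))) :
      Fin (n + 1) ⊕ Fin (n + 1) → Fin (n + 1) ⊕ Fin (n + 1) → ℂ)) /
    bdot q ^ (n + 1)

/-! ### Austere submanifolds -/

/-- `w` is the velocity at `s = 0` of (a lift of) the image under `Φ` of a smooth curve in the
normal bundle `NM` which passes through the normal vector `ν` at `x` for `s = 0`. These vectors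
form the tangent space of the immersed submanifold `Φ : NM → 𝓜` at `ν`. -/
def IsTangentAt (z : Coord k → Hom n) (x : Coord k) (ν : Hom n) (w : Pair n) : Prop :=
  ∃ (γ : ℝ → Coord k) (ξ : ℝ → Hom n), ContDiffAt ℝ ∞ γ 0 ∧ ContDiffAt ℝ ∞ ξ 0 ∧
    γ 0 = x ∧ ξ 0 = ν ∧ (∀ᶠ s in 𝓝 (0 : ℝ), IsNormal z (γ s) (ξ s)) ∧
    HasDerivAt (fun s => PhiHat (z (γ s)) (ξ s)) w 0

/-- The immersed submanifold `F : M → ℂP^n` is austere: its normal bundle is special Lagrangian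
(with some constant phase `e^{iφ}`) in `𝓜 ≅ TℂP^n` with the Stenzel metric, that is, `Ω` and
`Im (e^{iφ} Θ)` vanish on all tangent spaces of `Φ(NM)`. -/
def IsAustere (k : ℕ) {M : Type*} [TopologicalSpace M] [ChartedSpace (Coord k) M]
    (F : M → Projectivization ℂ (Hom n)) : Prop :=
  ∃ φ : ℝ, ∀ (p : M) (z : Coord k → Hom n), IsLiftAt F p z →
    ∀ ν : Hom n, IsNormal z (chartPt k p) ν →
      (∀ u v : Pair n, IsTangentAt z (chartPt k p) ν u → IsTangentAt z (chartPt k p) ν v →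
        stenzelForm (PhiHat (z (chartPt k p)) ν) u v = 0) ∧
      (∀ v : Fin n ⊕ Fin n → Pair n, (∀ a, IsTangentAt z (chartPt k p) ν (v a)) →
        (Complex.exp (φ * Complex.I) * holVol (PhiHat (z (chartPt k p)) ν) v).im = 0)

end CPAustere

end

/-!
The Stenzel potential is written in the lifts `(z, w)` and `Φ` is composed with a lift `z` of the
immersion to the unit sphere. On the normal bundle this gives, with `C = cosh |ν|` and
`S = sinh |ν| / |ν|`, the map `(x, ν) ↦ (C z + i S ν, C z̄ + i S ν̄)` (`stenzelMap`).

**The Lagrangian condition always holds.** The one-form `Df ∘ i`, which is a primitive of `Ω` up to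
a constant, vanishes on the normal bundle: `z · w` and `|z| |w|` are stationary in the directions
`i Φ_* (u, η)`, because normal vectors are orthogonal to the velocity of the base point
(`fderiv_potential_stenzelVelocity`). As the normal bundle is a manifold, parametrised with the
orthogonal projections onto the normal spaces, the differential of this one-form vanishes on it as
well (`ddc_eq_zero_of_eventually_dc_eq_zero`, `stenzelForm_eq_zero`).

**The phase of the volume form.** In a real orthonormal frame `f` of the horizontal space whose
first part is tangent and whose second part is normal, the tangent vectors of the normal bundle
expand, modulo the radial directions, in the vectors `(f, f̄)` (`exists_stenzelVelocity_eq`). The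
matrix of coefficients is block triangular. Its normal block is `i` times a real matrix, which is
invertible for `ν ≠ 0`. Its tangential block is `C + C⁻¹ S² p pᵀ - i S (ν · II)` (`shapeMatrix`),
where `p` is the tangential part of `J ν`. On the vectors `(f, f̄)` the volume form has a constant
phase (`exists_holVol_eq_det`), so up to a universal constant the phase of `Θ` is that of
`det (shapeMatrix)` (`exists_holVol_phase`).

**The polynomial.** For a unit normal vector `ν` and `t` real, the determinant at `t ν` is
`cosh^k t` times `det (1 - s H - s² p pᵀ)` with `s = i tanh t`. In an orthonormal basis whose first
vector is proportional to `p`, this is `∑ (-s)^d (H^{(d)} - |p|² Ĥ^{(d-2)})`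
(`det_one_sub_smul_sub_rankOne`, `det_shapeMatrix_smul`), and `|p|² = cos² θ` (`cos_angleTo_sq`).
The constant term is `1`, so the phase is constant along all rays if and only if all the odd
coefficients vanish (`odd_coeff_eq_zero_of_im_eq_zero`, `im_det_shapeMatrix_smul`). For degrees
larger than those in the theorem this is automatic (`phaseCoeff_eq_zero`).
-/

noncomputable section

namespace CPAustere

/-! ### Elementary symmetric functions of the eigenvalues as determinant coefficients -/

lemma elemSymm_natCast {m : ℕ} (A : Matrix (Fin m) (Fin m) ℝ) (d : ℕ) :
    elemSymm A d = A.charpoly.roots.esymm d := by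
  simp [elemSymm]

lemma elemSymm_eq_zero {m : ℕ} {A : Matrix (Fin m) (Fin m) ℝ} {d : ℕ} (hd : m < d) :
    elemSymm A d = 0 := by
  have h1 : A.charpoly.roots.card < d :=
    (Polynomial.card_roots' _).trans_lt (by simpa using hd)
  rw [elemSymm_natCast, Multiset.esymm, Multiset.powersetCard_eq_empty _ h1]
  simp

lemma elemSymm_zero {m : ℕ} (A : Matrix (Fin m) (Fin m) ℝ) : elemSymm A 0 = 1 := by
  simp [elemSymm, Multiset.esymm]

lemma det_one_sub_smul_map {m : ℕ} {A : Matrix (Fin m) (Fin m) ℝ} (hA : A.IsHermitian) (s : ℂ)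
    {N : ℕ} (hN : m < N) :
    (1 - s • A.map ((↑) : ℝ → ℂ)).det =
      ∑ d ∈ Finset.range N, (-s) ^ d * (elemSymm A d : ℂ) := by
  have hprod : (1 - s • A.map ((↑) : ℝ → ℂ)).det
      = ∏ i : Fin m, (1 + (-s) * ((hA.eigenvalues i : ℝ) : ℂ)) := by
    rcases eq_or_ne s 0 with rfl | hs
    · simp
    · have h1 : (1 - s • A.map ((↑) : ℝ → ℂ))
          = s • (Matrix.scalar (Fin m) s⁻¹ - A.map ((↑) : ℝ → ℂ)) := by
        ext i j
        by_cases h : i = j <;> simp [h, mul_sub, hs]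
      have h2 := Matrix.charpoly_map A Complex.ofRealHom
      have h3 := Matrix.eval_charpoly (A.map ((↑) : ℝ → ℂ)) s⁻¹
      rw [h1, Matrix.det_smul, ← h3]
      have h4 : (A.map ((↑) : ℝ → ℂ)).charpoly = A.charpoly.map Complex.ofRealHom := h2
      rw [h4, hA.charpoly_eq, Polynomial.map_prod, Polynomial.eval_prod, Fintype.card_fin]
      have : s ^ m = ∏ _i : Fin m, s := by simp
      rw [this, ← Finset.prod_mul_distrib]
      refine Finset.prod_congr rfl fun i _ => ?_
      simp only [Polynomial.map_sub, Polynomial.map_X, Polynomial.map_C, Polynomial.eval_sub,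
        Polynomial.eval_X, Polynomial.eval_C]
      rw [mul_sub, mul_inv_cancel₀ hs]
      simp [sub_eq_add_neg]
  rw [hprod, Finset.prod_one_add, Finset.sum_powerset]
  have hsub : Finset.range (m + 1) ⊆ Finset.range N := by
    intro x hx; simp at hx ⊢; omega
  rw [← Finset.sum_subset hsub]
  · simp only [Finset.card_univ, Fintype.card_fin]
    refine Finset.sum_congr rfl fun d _ => ?_
    rw [elemSymm_natCast, hA.roots_charpoly_eq_eigenvalues, Finset.esymm_map_val]
    push_cast
    rw [Finset.mul_sum]
    refine Finset.sum_congr rfl fun t ht => ?_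
    rw [Finset.prod_mul_distrib, Finset.prod_const, (Finset.mem_powersetCard.1 ht).2]
    simp
  · intro d _ hd
    rw [elemSymm_eq_zero (by simpa using hd)]
    simp

lemma det_add_single_zero_zero {m : ℕ} {R : Type*} [CommRing R]
    (A : Matrix (Fin (m + 1)) (Fin (m + 1)) R) (c : R) :
    Matrix.det (A + Matrix.single 0 0 c)
      = A.det + c * (A.submatrix Fin.succ Fin.succ).det := by
  have h0 : ∀ j : Fin (m + 1),
      Matrix.submatrix (A + Matrix.single 0 0 c) Fin.succ j.succAbove
        = A.submatrix Fin.succ j.succAbove := by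
    intro j
    ext a b
    simp [(Fin.succ_ne_zero a).symm]
  have h1 : ∀ j : Fin (m + 1), (Matrix.single 0 0 c : Matrix (Fin (m + 1)) (Fin (m + 1)) R) 0 j
      = if j = 0 then c else 0 := by
    intro j
    simp [Matrix.single_apply, eq_comm]
  rw [Matrix.det_succ_row_zero, Matrix.det_succ_row_zero A]
  simp only [h0, Matrix.add_apply, h1, mul_add, add_mul, Finset.sum_add_distrib]
  simp [Fin.succAbove_zero]

section AdaptedBasis

variable {k m : ℕ} {V W : Type*} [AddCommGroup V] [Module ℝ V] [NormedAddCommGroup W]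
  [InnerProductSpace ℝ W] {L : V →ₗ[ℝ] W} {η : W} {e : Fin k → V} {ehat : Fin m → V}

lemma finrank_range_of_orthonormal (he : Orthonormal ℝ fun a => L (e a))
    (hs : Submodule.span ℝ (Set.range fun a => L (e a)) = LinearMap.range L) :
    Module.finrank ℝ (LinearMap.range L) = k := by
  rw [← hs, finrank_span_eq_card he.linearIndependent, Fintype.card_fin]

/-- If the functional `⟪η, ·⟫` does not vanish on the range of `L`, an orthonormal basis of its
kernel is completed to one of the range of `L` by the normalised projection of `η`. -/
lemma exists_cons_orthonormal (he : Orthonormal ℝ fun a => L (e a))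
    (hs : Submodule.span ℝ (Set.range fun a => L (e a)) = LinearMap.range L)
    (he' : Orthonormal ℝ fun a => L (ehat a))
    (hs' : Submodule.span ℝ (Set.range fun a => L (ehat a)) = LinearMap.range L ⊓ (ℝ ∙ η)ᗮ)
    {a : Fin k} (ha : ⟪L (e a), η⟫_ℝ ≠ 0) :
    ∃ e₀ : V, Orthonormal ℝ (fun b => L ((Fin.cons e₀ ehat : Fin (m + 1) → V) b)) ∧
      Submodule.span ℝ (Set.range fun b => L ((Fin.cons e₀ ehat : Fin (m + 1) → V) b))
        = LinearMap.range L := by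
  set u₀ : V := ∑ b, ⟪L (e b), η⟫_ℝ • e b with hu₀
  have hLu : ∀ b, ⟪L u₀, L (e b)⟫_ℝ = ⟪η, L (e b)⟫_ℝ := by
    intro b
    simp only [hu₀, map_sum, map_smul]
    rw [he.inner_left_fintype, real_inner_comm]
    simp
  have hL : ∀ X ∈ LinearMap.range L, ⟪L u₀, X⟫_ℝ = ⟪η, X⟫_ℝ := by
    intro X hX
    rw [← hs] at hX
    induction hX using Submodule.span_induction with
    | mem x hx => obtain ⟨b, rfl⟩ := hx; exact hLu b
    | zero => simp
    | add x y _ _ hx hy => rw [inner_add_right, inner_add_right, hx, hy]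
    | smul c x _ hx => rw [inner_smul_right, inner_smul_right, hx]
  have hne : L u₀ ≠ 0 := by
    intro h0
    apply ha
    rw [real_inner_comm, ← hLu a, h0, inner_zero_left]
  have hn : ‖L u₀‖ ≠ 0 := norm_ne_zero_iff.2 hne
  have hmem : ∀ b, L (ehat b) ∈ LinearMap.range L ⊓ (ℝ ∙ η)ᗮ := fun b => by
    rw [← hs']; exact Submodule.subset_span ⟨b, rfl⟩
  have horth : ∀ b, ⟪L u₀, L (ehat b)⟫_ℝ = 0 := fun b => by
    rw [hL _ ⟨_, rfl⟩]
    exact Submodule.mem_orthogonal_singleton_iff_inner_right.1 (hmem b).2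
  refine ⟨‖L u₀‖⁻¹ • u₀, ?_, ?_⟩
  · rw [orthonormal_iff_ite]
    intro i j
    refine Fin.cases ?_ (fun i => ?_) i <;> refine Fin.cases ?_ (fun j => ?_) j
    · simp only [Fin.cons_zero, map_smul, real_inner_smul_left, real_inner_smul_right,
        if_true]
      rw [real_inner_self_eq_norm_sq]
      field_simp
    · simp [real_inner_smul_left, horth, (Fin.succ_ne_zero j).symm]
    · simp only [Fin.cons_succ, Fin.cons_zero, map_smul, inner_smul_right, Fin.succ_ne_zero,
        if_false]
      rw [real_inner_comm, horth, mul_zero]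
    · simpa using orthonormal_iff_ite.1 he' i j
  · refine le_antisymm (Submodule.span_le.2 ?_) ?_
    · rintro _ ⟨b, rfl⟩
      exact ⟨_, rfl⟩
    · intro X hX
      have h0 : L (‖L u₀‖⁻¹ • u₀) ∈
          Submodule.span ℝ (Set.range fun b => L ((Fin.cons (‖L u₀‖⁻¹ • u₀) ehat :
            Fin (m + 1) → V) b)) := Submodule.subset_span ⟨0, by simp⟩
      have hle : Submodule.span ℝ (Set.range fun b => L (ehat b)) ≤
          Submodule.span ℝ (Set.range fun b => L ((Fin.cons (‖L u₀‖⁻¹ • u₀) ehat :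
            Fin (m + 1) → V) b)) := by
        apply Submodule.span_mono
        rintro _ ⟨b, rfl⟩
        exact ⟨b.succ, by simp⟩
      have hY : X - (⟪L u₀, X⟫_ℝ / ‖L u₀‖ ^ 2) • L u₀ ∈ LinearMap.range L ⊓ (ℝ ∙ η)ᗮ := by
        have hr : X - (⟪L u₀, X⟫_ℝ / ‖L u₀‖ ^ 2) • L u₀ ∈ LinearMap.range L :=
          Submodule.sub_mem _ hX (Submodule.smul_mem _ _ ⟨u₀, rfl⟩)
        refine ⟨hr, Submodule.mem_orthogonal_singleton_iff_inner_right.2 ?_⟩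
        rw [← hL _ hr, inner_sub_right, inner_smul_right, real_inner_self_eq_norm_sq]
        field_simp
        ring
      rw [← hs'] at hY
      have h1 := Submodule.add_mem _ (hle hY)
        (Submodule.smul_mem _ ((⟪L u₀, X⟫_ℝ / ‖L u₀‖ ^ 2) * ‖L u₀‖) h0)
      have h2 : (⟪L u₀, X⟫_ℝ / ‖L u₀‖ ^ 2 * ‖L u₀‖) • L (‖L u₀‖⁻¹ • u₀)
          = (⟪L u₀, X⟫_ℝ / ‖L u₀‖ ^ 2) • L u₀ := by
        rw [map_smul, smul_smul, mul_assoc, mul_inv_cancel₀ hn, mul_one]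
      rw [h2] at h1
      simpa using h1

/-- Restricting to the orthogonal complement of `η` either changes nothing or lowers the dimension
by one. -/
lemma card_adapted (he : Orthonormal ℝ fun a => L (e a))
    (hs : Submodule.span ℝ (Set.range fun a => L (e a)) = LinearMap.range L)
    (he' : Orthonormal ℝ fun a => L (ehat a))
    (hs' : Submodule.span ℝ (Set.range fun a => L (ehat a)) = LinearMap.range L ⊓ (ℝ ∙ η)ᗮ) :
    ((∀ a, ⟪L (e a), η⟫_ℝ = 0) ∧ m = k) ∨ m + 1 = k := by
  by_cases h : ∀ a, ⟪L (e a), η⟫_ℝ = 0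
  · refine Or.inl ⟨h, ?_⟩
    have hle : LinearMap.range L ⊓ (ℝ ∙ η)ᗮ = LinearMap.range L := by
      refine inf_eq_left.2 ?_
      rw [← hs, Submodule.span_le]
      rintro _ ⟨a, rfl⟩
      exact Submodule.mem_orthogonal_singleton_iff_inner_left.2 (h a)
    rw [hle] at hs'
    rw [← finrank_range_of_orthonormal he hs, finrank_range_of_orthonormal he' hs']
  · push Not at h
    obtain ⟨a, ha⟩ := h
    obtain ⟨e₀, h1, h2⟩ := exists_cons_orthonormal he hs he' hs' ha
    right
    rw [← finrank_range_of_orthonormal he hs, finrank_range_of_orthonormal h1 h2]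

/-- In an orthonormal basis whose first vector is the direction of the projection of `η`, the
rank-one term sits in a single diagonal entry, and the complementary minor is the restriction of
the form to `η^⊥`. -/
theorem det_one_sub_smul_sub_rankOne [FiniteDimensional ℝ V] (hV : Module.finrank ℝ V = k)
    (he : Orthonormal ℝ fun a => L (e a))
    (hs : Submodule.span ℝ (Set.range fun a => L (e a)) = LinearMap.range L)
    (he' : Orthonormal ℝ fun a => L (ehat a))
    (hs' : Submodule.span ℝ (Set.range fun a => L (ehat a)) = LinearMap.range L ⊓ (ℝ ∙ η)ᗮ)
    (h : V →ₗ[ℝ] V →ₗ[ℝ] ℝ) (hsymm : ∀ u v, h u v = h v u) (s : ℂ) {N : ℕ} (hN : k < N) :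
    (Matrix.of fun a b => (if a = b then (1 : ℂ) else 0) - s * (h (e a) (e b) : ℂ)
        - s ^ 2 * ((⟪L (e a), η⟫_ℝ * ⟪L (e b), η⟫_ℝ : ℝ) : ℂ)).det
      = (∑ d ∈ Finset.range N, (-s) ^ d *
          (elemSymm (Matrix.of fun a b => h (e a) (e b)) d : ℂ))
        - ((∑ a, ⟪L (e a), η⟫_ℝ ^ 2 : ℝ) : ℂ) * ∑ d ∈ Finset.range N, (-s) ^ (d + 2) *
          (elemSymm (Matrix.of fun a b => h (ehat a) (ehat b)) d : ℂ) := by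
  have hherm : ∀ {l : ℕ} (f : Fin l → V), (Matrix.of fun a b => h (f a) (f b)).IsHermitian := by
    intro l f
    ext a b
    simp [hsymm (f b)]
  rw [← det_one_sub_smul_map (hherm e) s hN]
  by_cases h0 : ∀ a, ⟪L (e a), η⟫_ℝ = 0
  · simp only [h0]
    simp
    rfl
  · push Not at h0
    obtain ⟨a, ha⟩ := h0
    obtain ⟨e₀, h1, h2⟩ := exists_cons_orthonormal he hs he' hs' ha
    have hk : k = m + 1 := by
      rw [← finrank_range_of_orthonormal he hs, finrank_range_of_orthonormal h1 h2]
    subst hk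
    set f : Fin (m + 1) → V := Fin.cons e₀ ehat with hf
    have hinj : Function.Injective L := by
      rw [← LinearMap.ker_eq_bot]
      have := L.finrank_range_add_finrank_ker
      rw [finrank_range_of_orthonormal he hs, hV] at this
      exact Submodule.finrank_eq_zero.1 (by omega)
    set O : Matrix (Fin (m + 1)) (Fin (m + 1)) ℝ := Matrix.of fun a b => ⟪L (e b), L (f a)⟫_ℝ
      with hO
    have hfe : ∀ a, f a = ∑ b, O a b • e b := by
      intro a
      apply hinj
      have hm : L (f a) ∈ Submodule.span ℝ (Set.range fun a => L (e a)) := by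
        rw [hs]; exact ⟨_, rfl⟩
      obtain ⟨c, hc⟩ := (Submodule.mem_span_range_iff_exists_fun ℝ).1 hm
      rw [map_sum]
      simp only [map_smul, hO, Matrix.of_apply]
      rw [← hc]
      refine Finset.sum_congr rfl fun b _ => ?_
      rw [he.inner_right_fintype]
    have hOO : O * O.transpose = 1 := by
      ext a b
      have h3 := orthonormal_iff_ite.1 h1 a b
      rw [hfe a, map_sum, sum_inner] at h3
      simp only [map_smul, inner_smul_left] at h3
      rw [Matrix.mul_apply, Matrix.one_apply, ← h3]
      rfl
    have hdetO : ((O.det : ℝ) : ℂ) * O.det = 1 := by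
      have := congrArg Matrix.det hOO
      rw [Matrix.det_mul, Matrix.det_transpose, Matrix.det_one] at this
      exact_mod_cast this
    have hη : ∀ a, ⟪L (f a), η⟫_ℝ = ∑ b, O a b * ⟪L (e b), η⟫_ℝ := by
      intro a
      rw [hfe a, map_sum, sum_inner]
      simp [inner_smul_left]
    have hh : ∀ a b, h (f a) (f b) = ∑ c, ∑ d, O a c * h (e c) (e d) * O b d := by
      intro a b
      rw [hfe a, hfe b]
      simp only [map_sum, LinearMap.sum_apply, map_smul, LinearMap.smul_apply, smul_eq_mul,
        Finset.mul_sum]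
      rw [Finset.sum_comm]
      exact Finset.sum_congr rfl fun c _ => Finset.sum_congr rfl fun d _ => by ring
    -- The determinant does not depend on the orthonormal basis.
    have hbasis : ∀ c : ℂ,
        (Matrix.of fun a b => (if a = b then (1 : ℂ) else 0) - s * (h (e a) (e b) : ℂ)
          - c * ((⟪L (e a), η⟫_ℝ * ⟪L (e b), η⟫_ℝ : ℝ) : ℂ)).det =
        (Matrix.of fun a b => (if a = b then (1 : ℂ) else 0) - s * (h (f a) (f b) : ℂ)
          - c * ((⟪L (f a), η⟫_ℝ * ⟪L (f b), η⟫_ℝ : ℝ) : ℂ)).det := by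
      intro c
      set A := (Matrix.of fun a b => (if a = b then (1 : ℂ) else 0) - s * (h (e a) (e b) : ℂ)
          - c * ((⟪L (e a), η⟫_ℝ * ⟪L (e b), η⟫_ℝ : ℝ) : ℂ)) with hA
      have hO' : (O.map Complex.ofRealHom).det = ((O.det : ℝ) : ℂ) :=
        (RingHom.map_det Complex.ofRealHom O).symm
      have hconj : (Matrix.of fun a b => (if a = b then (1 : ℂ) else 0) - s * (h (f a) (f b) : ℂ)
          - c * ((⟪L (f a), η⟫_ℝ * ⟪L (f b), η⟫_ℝ : ℝ) : ℂ))
          = O.map Complex.ofRealHom * A * (O.map Complex.ofRealHom).transpose := by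
        ext a b
        have h1 : (if a = b then (1 : ℂ) else 0) = ∑ c, ∑ d, ((O a c : ℂ) *
            (if c = d then 1 else 0) * (O b d : ℂ)) := by
          have := congrFun (congrFun hOO a) b
          rw [Matrix.mul_apply, Matrix.one_apply] at this
          simp only [mul_ite, mul_one, mul_zero, ite_mul, zero_mul, Finset.sum_ite_eq,
            Finset.mem_univ, if_true]
          split_ifs at this ⊢ <;> exact_mod_cast this.symm
        have h2 : ⟪L (f a), η⟫_ℝ * ⟪L (f b), η⟫_ℝ = ∑ c, ∑ d,
            O a c * (⟪L (e c), η⟫_ℝ * ⟪L (e d), η⟫_ℝ) * O b d := by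
          rw [hη a, hη b, Finset.sum_mul_sum]
          exact Finset.sum_congr rfl fun c _ => Finset.sum_congr rfl fun d _ => by ring
        simp only [Matrix.mul_apply, Matrix.of_apply, Matrix.transpose_apply, Matrix.map_apply,
          Finset.sum_mul, hA, Complex.ofRealHom_eq_coe]
        rw [h1, hh, h2]
        conv_rhs => rw [Finset.sum_comm]
        push_cast
        rw [Finset.mul_sum, Finset.mul_sum, ← Finset.sum_sub_distrib, ← Finset.sum_sub_distrib]
        refine Finset.sum_congr rfl fun i _ => ?_
        rw [Finset.mul_sum, Finset.mul_sum, ← Finset.sum_sub_distrib, ← Finset.sum_sub_distrib]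
        exact Finset.sum_congr rfl fun j _ => by ring
      rw [hconj, Matrix.det_mul, Matrix.det_mul, Matrix.det_transpose, hO', mul_right_comm, hdetO,
        one_mul]
    have hη0 : ∀ a : Fin m, ⟪L (f a.succ), η⟫_ℝ = 0 := by
      intro a
      have : L (ehat a) ∈ LinearMap.range L ⊓ (ℝ ∙ η)ᗮ := by
        rw [← hs']; exact Submodule.subset_span ⟨a, rfl⟩
      simpa [hf] using Submodule.mem_orthogonal_singleton_iff_inner_left.1 this.2
    have hηsq : ⟪L (f 0), η⟫_ℝ * ⟪L (f 0), η⟫_ℝ = ∑ a, ⟪L (e a), η⟫_ℝ ^ 2 := by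
      have h3 : ∑ a, ⟪L (f a), η⟫_ℝ ^ 2 = ∑ a, ⟪L (e a), η⟫_ℝ ^ 2 := by
        have hOO' := mul_eq_one_comm.1 hOO
        calc ∑ a, ⟪L (f a), η⟫_ℝ ^ 2
            = ∑ b, ∑ c, (O.transpose * O) b c * (⟪L (e b), η⟫_ℝ * ⟪L (e c), η⟫_ℝ) := by
              simp only [hη, sq, Finset.sum_mul_sum]
              rw [Finset.sum_comm]
              refine Finset.sum_congr rfl fun b _ => ?_
              rw [Finset.sum_comm]
              simp only [Matrix.mul_apply, Matrix.transpose_apply, Finset.sum_mul]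
              exact Finset.sum_congr rfl fun c _ => Finset.sum_congr rfl fun d _ => by ring
          _ = _ := by
              rw [hOO']
              simp [Matrix.one_apply, sq]
      rw [← h3, Fin.sum_univ_succ]
      simp [hη0, sq]
    have h4 : (1 - s • (Matrix.of fun a b => h (e a) (e b)).map ((↑) : ℝ → ℂ)).det
        = (Matrix.of fun a b => (if a = b then (1 : ℂ) else 0) - s * (h (f a) (f b) : ℂ)).det := by
      have := hbasis 0
      simp only [zero_mul, sub_zero] at this
      rw [← this]
      congr 1
    rw [hbasis, h4]
    have h5 : (Matrix.of fun a b => (if a = b then (1 : ℂ) else 0) - s * (h (f a) (f b) : ℂ)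
          - s ^ 2 * ((⟪L (f a), η⟫_ℝ * ⟪L (f b), η⟫_ℝ : ℝ) : ℂ))
        = (Matrix.of fun a b => (if a = b then (1 : ℂ) else 0) - s * (h (f a) (f b) : ℂ))
          + Matrix.single 0 0 (- (s ^ 2 * ((∑ a, ⟪L (e a), η⟫_ℝ ^ 2 : ℝ) : ℂ))) := by
      rw [← hηsq]
      ext a b
      refine Fin.cases ?_ (fun a => ?_) a <;> refine Fin.cases ?_ (fun b => ?_) b
      · simp [sub_eq_add_neg]
      · simp [hη0, (Fin.succ_ne_zero b).symm]
      · simp [hη0, (Fin.succ_ne_zero a).symm]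
      · simp [hη0, (Fin.succ_ne_zero a).symm]
    rw [h5, det_add_single_zero_zero]
    have h6 : (Matrix.of fun a b => (if a = b then (1 : ℂ) else 0)
          - s * (h (f a) (f b) : ℂ)).submatrix Fin.succ Fin.succ
        = 1 - s • (Matrix.of fun a b => h (ehat a) (ehat b)).map ((↑) : ℝ → ℂ) := by
      ext a b
      simp [hf, Matrix.one_apply]
    rw [h6, det_one_sub_smul_map (hherm ehat) s (show m < N by omega)]
    rw [neg_mul, sub_eq_add_neg, Finset.mul_sum, Finset.mul_sum]
    congr 2
    exact Finset.sum_congr rfl fun d _ => by ring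

end AdaptedBasis

/-- A non-zero constant which rotates the values on `(0, 1)` of a polynomial `∑ c_d (-i t)^d` with
real `c_d` and `c_0 = 1` to the real axis is itself real, so the odd coefficients vanish. -/
theorem odd_coeff_eq_zero_of_im_eq_zero {N : ℕ} {c : ℕ → ℝ} (hc : c 0 = 1) (hN : 0 < N)
    {κ : ℂ} (hκ : κ ≠ 0)
    (h : ∀ t : ℝ, 0 < t → t < 1 →
      (κ * ∑ d ∈ Finset.range N, (-(Complex.I * t)) ^ d * (c d : ℂ)).im = 0) :
    ∀ j, 2 * j + 1 < N → c (2 * j + 1) = 0 := by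
  -- The imaginary part is a real polynomial in `t` with infinitely many zeros.
  set p : Polynomial ℝ := ∑ d ∈ Finset.range N,
    Polynomial.monomial d ((κ * (-Complex.I) ^ d).im * c d) with hp
  have hp0 : p = 0 := by
    refine Polynomial.eq_zero_of_infinite_isRoot p ((Set.Ioo_infinite one_pos).mono ?_)
    intro t ht
    have := h t ht.1 ht.2
    rw [Set.mem_ofPred_eq, Polynomial.IsRoot, hp, Polynomial.eval_finsetSum, ← this,
      Finset.mul_sum, Complex.im_sum]
    refine Finset.sum_congr rfl fun d _ => ?_
    rw [Polynomial.eval_monomial]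
    have : κ * ((-(Complex.I * t)) ^ d * (c d : ℂ))
        = (κ * (-Complex.I) ^ d) * ((c d * t ^ d : ℝ) : ℂ) := by
      push_cast
      rw [← neg_mul, mul_pow]
      ring
    rw [this, Complex.im_mul_ofReal]
    ring
  have hcoeff : ∀ d < N, (κ * (-Complex.I) ^ d).im * c d = 0 := by
    intro d hd
    have := congrArg (fun q => Polynomial.coeff q d) hp0
    simpa [hp, Polynomial.finsetSum_coeff, Polynomial.coeff_monomial, hd] using this
  have him : κ.im = 0 := by simpa [hc] using hcoeff 0 hN
  have hre : κ.re ≠ 0 := fun h0 => hκ (Complex.ext h0 him)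
  intro j hj
  have h1 := hcoeff _ hj
  have h2 : (-Complex.I) ^ (2 * j + 1) = ((-((-1) ^ j) : ℝ) : ℂ) * Complex.I := by
    rw [pow_succ, pow_mul]
    simp
  rw [h2, mul_left_comm, Complex.im_ofReal_mul, Complex.mul_I_im] at h1
  simpa [hre] using h1

/-! ### Hyperbolic functions of the squared norm -/

/-- The entire function `t ↦ cosh √t`. -/
def coshSqrt (t : ℝ) : ℝ := ∑' j : ℕ, ((2 * j).factorial : ℝ)⁻¹ • t ^ j

/-- The entire function `t ↦ sinh √t / √t`. -/
def sinhcSqrt (t : ℝ) : ℝ := ∑' j : ℕ, ((2 * j + 1).factorial : ℝ)⁻¹ • t ^ j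

lemma contDiff_tsum_inv_factorial (r : ℕ) :
    ContDiff ℝ ∞ fun t : ℝ => ∑' j : ℕ, ((2 * j + r).factorial : ℝ)⁻¹ • t ^ j := by
  set c : ℕ → ℝ := fun j => ((2 * j + r).factorial : ℝ)⁻¹ with hc
  have hrad : (FormalMultilinearSeries.ofScalars ℝ c).radius = ⊤ := by
    refine FormalMultilinearSeries.ofScalars_radius_eq_top_of_tendsto ℝ c
      (Filter.Eventually.of_forall fun j => by positivity) ?_
    refine squeeze_zero (fun j => by positivity) (g := fun j : ℕ => ((j : ℝ) + 1)⁻¹) ?_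
      (by simpa using tendsto_one_div_add_atTop_nhds_zero_nat (𝕜 := ℝ))
    intro j
    have h1 : ((2 * (j + 1) + r).factorial : ℝ)
        = (2 * j + r + 2) * ((2 * j + r + 1) * (2 * j + r).factorial) := by
      rw [show 2 * (j + 1) + r = (2 * j + r + 1) + 1 by ring, Nat.factorial_succ,
        Nat.factorial_succ]
      push_cast
      ring
    have hpos : (0 : ℝ) < (2 * j + r).factorial := by positivity
    simp only [hc, Nat.succ_eq_add_one, norm_inv, Real.norm_natCast]
    rw [h1, div_inv_eq_mul, mul_inv, mul_inv, mul_assoc, mul_assoc, inv_mul_cancel₀ hpos.ne',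
      mul_one]
    have h2 : ((2 * j + r + 2 : ℝ))⁻¹ ≤ ((j : ℝ) + 1)⁻¹ := by
      apply inv_anti₀ (by positivity)
      have : (0 : ℝ) ≤ r := by positivity
      have : (0 : ℝ) ≤ j := by positivity
      linarith
    have h3 : ((2 * j + r + 1 : ℝ))⁻¹ ≤ 1 := by
      apply inv_le_one_of_one_le₀
      have : (0 : ℝ) ≤ r := by positivity
      have : (0 : ℝ) ≤ j := by positivity
      linarith
    calc _ ≤ ((j : ℝ) + 1)⁻¹ * 1 := mul_le_mul h2 h3 (by positivity) (by positivity)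
      _ = _ := mul_one _
  have h := (FormalMultilinearSeries.ofScalars ℝ c).hasFPowerSeriesOnBall (by rw [hrad]; simp)
  have han : AnalyticOnNhd ℝ (FormalMultilinearSeries.ofScalars ℝ c).sum Set.univ := by
    have := h.analyticOnNhd
    rwa [hrad, Metric.eball_top] at this
  have heq : (FormalMultilinearSeries.ofScalars ℝ c).sum = fun t : ℝ => ∑' j : ℕ, c j • t ^ j :=
    funext fun t => FormalMultilinearSeries.ofScalars_sum_eq c t
  rw [heq] at han
  exact han.contDiff

lemma contDiff_coshSqrt : ContDiff ℝ ∞ coshSqrt := contDiff_tsum_inv_factorial 0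

lemma contDiff_sinhcSqrt : ContDiff ℝ ∞ sinhcSqrt := contDiff_tsum_inv_factorial 1

lemma coshSqrt_sq (x : ℝ) : coshSqrt (x ^ 2) = Real.cosh x := by
  have h := Complex.hasSum_cos' (x * Complex.I)
  rw [Complex.cos_mul_I] at h
  have h2 : HasSum (fun j : ℕ => ((2 * j).factorial : ℝ)⁻¹ • (x ^ 2) ^ j) (Real.cosh x) := by
    rw [← Complex.hasSum_ofReal]
    push_cast
    convert! h using 2 with j
    rw [mul_assoc, Complex.I_mul_I, pow_mul]
    simp [div_eq_inv_mul]
  exact h2.tsum_eq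

lemma sinhcSqrt_sq_mul (x : ℝ) : sinhcSqrt (x ^ 2) * x = Real.sinh x := by
  have h := Complex.hasSum_sin' (x * Complex.I)
  rw [Complex.sin_mul_I] at h
  have h2 : HasSum (fun j : ℕ => ((2 * j + 1).factorial : ℝ)⁻¹ • (x ^ 2) ^ j * x)
      (Real.sinh x) := by
    rw [← Complex.hasSum_ofReal]
    push_cast
    have h3 := h.mul_right (-Complex.I)
    have h4 : Complex.sinh x * Complex.I * -Complex.I = Complex.sinh x := by
      rw [mul_assoc, mul_neg, Complex.I_mul_I, neg_neg, mul_one]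
    rw [h4] at h3
    convert! h3 using 2 with j
    rw [mul_assoc (x : ℂ), Complex.I_mul_I, mul_neg_one, Odd.neg_pow ⟨j, rfl⟩, smul_eq_mul]
    have hI := Complex.I_ne_zero
    have hF : ((2 * j + 1).factorial : ℂ) ≠ 0 := by exact_mod_cast Nat.factorial_ne_zero _
    push_cast
    field_simp
    ring
  rw [sinhcSqrt, ← tsum_mul_right]
  exact h2.tsum_eq

lemma coshSqrt_zero : coshSqrt 0 = 1 := by simpa using coshSqrt_sq 0

lemma sinhcSqrt_zero : sinhcSqrt 0 = 1 := by
  have h := tsum_eq_single (L := .unconditional ℕ)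
    (f := fun j : ℕ => ((2 * j + 1).factorial : ℝ)⁻¹ • (0 : ℝ) ^ j) 0
    (fun j hj => by simp [hj])
  rw [sinhcSqrt, h]
  simp

lemma coshSqrt_sq_sub (x : ℝ) :
    coshSqrt (x ^ 2) ^ 2 - sinhcSqrt (x ^ 2) ^ 2 * x ^ 2 = 1 := by
  rw [← mul_pow, sinhcSqrt_sq_mul, coshSqrt_sq, Real.cosh_sq]
  ring

lemma coshSqrt_sq_pos (x : ℝ) : 0 < coshSqrt (x ^ 2) := by
  rw [coshSqrt_sq]; exact Real.cosh_pos x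

lemma deriv_coshSqrt_sq (x : ℝ) (hx : x ≠ 0) :
    2 * deriv coshSqrt (x ^ 2) = sinhcSqrt (x ^ 2) := by
  have h1 : HasDerivAt coshSqrt (deriv coshSqrt (x ^ 2)) (x ^ 2) :=
    (contDiff_coshSqrt.differentiable (by simp) _).hasDerivAt
  have h2 := h1.comp (h := fun x : ℝ => x ^ 2) x (hasDerivAt_pow 2 x)
  have h3 : coshSqrt ∘ (fun x => x ^ 2) = Real.cosh := funext coshSqrt_sq
  rw [h3] at h2
  have h4 := h2.unique (Real.hasDerivAt_cosh x)
  have h5 := sinhcSqrt_sq_mul x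
  apply mul_right_cancel₀ hx
  rw [h5, ← h4]
  simp
  ring

lemma deriv_sinhcSqrt_sq (x : ℝ) :
    2 * deriv sinhcSqrt (x ^ 2) * x ^ 2 = coshSqrt (x ^ 2) - sinhcSqrt (x ^ 2) := by
  have h1 : HasDerivAt sinhcSqrt (deriv sinhcSqrt (x ^ 2)) (x ^ 2) :=
    (contDiff_sinhcSqrt.differentiable (by simp) _).hasDerivAt
  have h2 := (h1.comp (h := fun x : ℝ => x ^ 2) x (hasDerivAt_pow 2 x)).mul (hasDerivAt_id x)
  have h3 : (sinhcSqrt ∘ (fun x => x ^ 2)) * id = Real.sinh := funext sinhcSqrt_sq_mul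
  rw [h3] at h2
  have h4 := h2.unique (Real.hasDerivAt_sinh x)
  rw [coshSqrt_sq, ← h4]
  simp
  ring

/-! ### A smooth family of projections -/

/-- The common orthogonal complements of smoothly varying linearly independent vectors are the
images of a smooth family of linear maps, which are projections. -/
theorem exists_contDiffAt_proj {G W ι : Type*} [NormedAddCommGroup G] [NormedSpace ℝ G]
    [NormedAddCommGroup W] [InnerProductSpace ℝ W] [FiniteDimensional ℝ W] [Fintype ι]
    {m : ℕ∞ω} {a : ι → G → W} {x : G} (ha : ∀ i, ContDiffAt ℝ m (a i) x)
    (hli : LinearIndependent ℝ fun i => a i x) :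
    ∃ P : G → W →L[ℝ] W, ContDiffAt ℝ m P x ∧
      ∀ᶠ y in 𝓝 x, (∀ i v, ⟪a i y, P y v⟫_ℝ = 0) ∧
        ∀ v, (∀ i, ⟪a i y, v⟫_ℝ = 0) → P y v = v := by
  have : CompleteSpace W := FiniteDimensional.complete ℝ W
  set K : Submodule ℝ W := Submodule.span ℝ (Set.range fun i => a i x) with hK
  set P₀ : W →L[ℝ] W := Kᗮ.starProjection with hP₀
  have haK : ∀ i, a i x ∈ K := fun i => Submodule.subset_span ⟨i, rfl⟩
  -- `B y` is the composition of `a i x ↤ ⟪a i y, ·⟫` over all `i`; its values are orthogonal to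
  -- those of `P₀`.
  set B : G → W →L[ℝ] W := fun y => ∑ i, (innerSL ℝ (a i y)).smulRight (a i x) with hB
  have hBv : ∀ y v, B y v = ∑ i, ⟪a i y, v⟫_ℝ • a i x := by
    intro y v
    simp [hB]
  have hBK : ∀ y v, B y v ∈ K := fun y v => by
    rw [hBv]; exact Submodule.sum_mem _ fun i _ => Submodule.smul_mem _ _ (haK i)
  have hP₀K : ∀ v, P₀ v ∈ Kᗮ := fun v => by simp [hP₀]
  have hBzero : ∀ y v, B y v = 0 → ∀ i, ⟪a i y, v⟫_ℝ = 0 := by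
    intro y v h
    rw [hBv] at h
    exact Fintype.linearIndependent_iff.1 hli _ h
  have hsplit : ∀ u ∈ Kᗮ, ∀ w ∈ K, u + w ∈ Kᗮ → w = 0 := by
    intro u hu w hw h
    have h1 : w ∈ Kᗮ := by simpa using Submodule.sub_mem _ h hu
    exact inner_self_eq_zero.1 (Submodule.inner_right_of_mem_orthogonal hw h1)
  have hBsmooth : ContDiffAt ℝ m B x := by
    apply ContDiffAt.sum
    intro i _
    have h1 : ContDiffAt ℝ m (fun y => innerSL ℝ (a i y)) x :=
      (innerSL ℝ (E := W)).contDiff.contDiffAt.comp x (ha i)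
    exact h1.smulRight contDiffAt_const
  have hinj : Function.Injective (P₀ + B x) := by
    rw [injective_iff_map_eq_zero]
    intro v hv
    have h1 : P₀ v + B x v = 0 := hv
    have h2 : B x v = 0 := hsplit _ (hP₀K v) _ (hBK x v) (by rw [h1]; exact Submodule.zero_mem _)
    have h3 : v ∈ Kᗮ := by
      rw [Submodule.mem_orthogonal]
      intro u hu
      induction hu using Submodule.span_induction with
      | mem u hu => obtain ⟨i, rfl⟩ := hu; exact hBzero x v h2 i
      | zero => simp
      | add u w _ _ hu hw => rw [inner_add_left, hu, hw, add_zero]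
      | smul c u _ hu => rw [inner_smul_left, hu, mul_zero]
    rw [h2, add_zero, hP₀, Submodule.starProjection_eq_self_iff.2 h3] at h1
    exact h1
  set T : W ≃L[ℝ] W := (LinearEquiv.ofInjectiveEndo (P₀ + B x : W →L[ℝ] W).toLinearMap
    hinj).toContinuousLinearEquiv with hT
  have hTc : (T : W →L[ℝ] W) = P₀ + B x := by
    ext v
    rfl
  have hsmooth : ContDiffAt ℝ m (fun y => P₀ + B y) x := contDiffAt_const.add hBsmooth
  have hinv : ContDiffAt ℝ m (fun y => ContinuousLinearMap.inverse (P₀ + B y)) x := by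
    have h1 := contDiffAt_map_inverse (n := m) T
    rw [hTc] at h1
    exact h1.comp x hsmooth
  refine ⟨fun y => (ContinuousLinearMap.inverse (P₀ + B y)).comp P₀,
    hinv.clm_comp contDiffAt_const, ?_⟩
  have hev : ∀ᶠ y in 𝓝 x, P₀ + B y ∈ Set.range ((↑) : (W ≃L[ℝ] W) → W →L[ℝ] W) := by
    apply hsmooth.continuousAt.eventually
    change _ ∈ 𝓝 (P₀ + B x)
    rw [← hTc]
    exact ContinuousLinearEquiv.nhds T
  filter_upwards [hev] with y hy
  obtain ⟨S, hS⟩ := hy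
  have hSv : ∀ v, S v = P₀ v + B y v := fun v => by
    have : (S : W →L[ℝ] W) v = (P₀ + B y) v := by rw [hS]
    exact this
  constructor
  · intro i v
    simp only [← hS, ContinuousLinearMap.inverse_equiv, ContinuousLinearMap.comp_apply]
    refine hBzero y _ ?_ i
    have h1 := hSv (S.symm (P₀ v))
    rw [ContinuousLinearEquiv.apply_symm_apply] at h1
    exact hsplit _ (hP₀K _) _ (hBK y _) (h1 ▸ hP₀K v)
  · intro v hv
    simp only [← hS, ContinuousLinearMap.inverse_equiv, ContinuousLinearMap.comp_apply]
    have h1 := hSv v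
    rw [hBv, Finset.sum_eq_zero fun i _ => by rw [hv i, zero_smul], add_zero] at h1
    rw [← h1]
    exact S.symm_apply_apply v

/-! ### Isotropy from the vanishing of a primitive -/

/-- If the one-form `Df ∘ i`, whose differential is twice `i∂∂̄f`, vanishes along a map `Ψ`, then
so does its differential. -/
theorem ddc_eq_zero_of_eventually_dc_eq_zero {G E : Type*} [NormedAddCommGroup G]
    [NormedSpace ℝ G] [NormedAddCommGroup E] [NormedSpace ℂ E] {f : E → ℝ} {Ψ : G → E} {y : G}
    (hf : ContDiffAt ℝ 2 f (Ψ y)) (hΨ : ContDiffAt ℝ 2 Ψ y)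
    (h : ∀ᶠ x in 𝓝 y, ∀ u, fderiv ℝ f (Ψ x) (Complex.I • fderiv ℝ Ψ x u) = 0) (u v : G) :
    fderiv ℝ (fderiv ℝ f) (Ψ y) (Complex.I • fderiv ℝ Ψ y u) (fderiv ℝ Ψ y v)
      - fderiv ℝ (fderiv ℝ f) (Ψ y) (fderiv ℝ Ψ y u) (Complex.I • fderiv ℝ Ψ y v) = 0 := by
  have hf1 : DifferentiableAt ℝ (fderiv ℝ f) (Ψ y) :=
    (hf.fderiv_right (m := 1) (by norm_num)).differentiableAt (by norm_num)
  have hΨ1 : DifferentiableAt ℝ (fderiv ℝ Ψ) y :=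
    (hΨ.fderiv_right (m := 1) (by norm_num)).differentiableAt (by norm_num)
  have hΨ0 : DifferentiableAt ℝ Ψ y := hΨ.differentiableAt (by norm_num)
  have hsf : IsSymmSndFDerivAt ℝ f (Ψ y) := hf.isSymmSndFDerivAt (by simp)
  have hsΨ : IsSymmSndFDerivAt ℝ Ψ y := hΨ.isSymmSndFDerivAt (by simp)
  have key : ∀ u v, fderiv ℝ (fderiv ℝ f) (Ψ y) (fderiv ℝ Ψ y v) (Complex.I • fderiv ℝ Ψ y u)
      + fderiv ℝ f (Ψ y) (Complex.I • fderiv ℝ (fderiv ℝ Ψ) y v u) = 0 := by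
    intro u v
    have h1 : HasFDerivAt (fun x => fderiv ℝ f (Ψ x)) ((fderiv ℝ (fderiv ℝ f) (Ψ y)).comp
        (fderiv ℝ Ψ y)) y := hf1.hasFDerivAt.comp y hΨ0.hasFDerivAt
    have h2 : HasFDerivAt (fun x => Complex.I • fderiv ℝ Ψ x u)
        (Complex.I • (fderiv ℝ (fderiv ℝ Ψ) y).flip u) y := by
      have := (hΨ1.hasFDerivAt.clm_apply (hasFDerivAt_const u y)).const_smul Complex.I
      convert! this using 1
      ext w
      simp
    have h3 := h1.clm_apply h2
    have h4 : (fun x => fderiv ℝ f (Ψ x) (Complex.I • fderiv ℝ Ψ x u)) =ᶠ[𝓝 y] fun _ => 0 :=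
      h.mono fun x hx => hx u
    have h5 := (h3.congr_of_eventuallyEq h4.symm).unique (hasFDerivAt_const (0 : ℝ) y)
    have h6 := congrArg (fun A => A v) h5
    simp at h6
    linarith
  have h1 := key u v
  have h2 := key v u
  rw [hsf.eq] at h1
  rw [hsΨ.eq v u] at h1
  linarith

section

variable {n : ℕ}

/-! ### Real and Hermitian products -/

lemma real_inner_eq_re (x y : Hom n) : ⟪x, y⟫_ℝ = (⟪x, y⟫_ℂ).re :=
  by simp [PiLp.inner_apply, Complex.inner, Complex.re_sum]

lemma inner_J_right (x y : Hom n) : ⟪x, J y⟫_ℝ = -(⟪x, y⟫_ℂ).im := by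
  rw [real_inner_eq_re, J, inner_smul_right]
  simp

@[simp] lemma conjVec_apply (v : Hom n) (i : Fin (n + 1)) :
    conjVec v i = (starRingEnd ℂ) (v i) := rfl

lemma sum_mul_conjVec (x y : Hom n) : ∑ j, x j * conjVec y j = ⟪y, x⟫_ℂ := by
  simp [PiLp.inner_apply]

lemma conjVec_add (x y : Hom n) : conjVec (x + y) = conjVec x + conjVec y := by
  ext i; simp

lemma inner_conjVec (x y : Hom n) : ⟪conjVec x, conjVec y⟫_ℂ = ⟪y, x⟫_ℂ := by
  simp [PiLp.inner_apply, mul_comm]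

lemma norm_conjVec (x : Hom n) : ‖conjVec x‖ = ‖x‖ := by
  simp [EuclideanSpace.norm_eq]

/-- Complex conjugation of coordinates as a real-linear map. -/
def conjVecL : Hom n →L[ℝ] Hom n :=
  LinearMap.toContinuousLinearMap
    { toFun := conjVec
      map_add' := conjVec_add
      map_smul' := fun c x => by
        ext i
        simp }

@[simp] lemma conjVecL_apply (x : Hom n) : conjVecL x = conjVec x := rfl

/-- The pair `(v, v̄)`. The pairs of this form with `v` orthogonal to `ζ` form a real structure on
`ζ^⊥ × ζ̄^⊥`. -/
def realPair (v : Hom n) : Pair n := (v, conjVec v)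

lemma realPair_add (x y : Hom n) : realPair (x + y) = realPair x + realPair y := by
  simp [realPair, conjVec_add]

lemma realPair_smul (c : ℝ) (x : Hom n) : realPair (c • x) = (c : ℂ) • realPair x := by
  ext i <;> simp [realPair]

lemma realPair_sum {ι : Type*} (s : Finset ι) (x : ι → Hom n) :
    realPair (∑ i ∈ s, x i) = ∑ i ∈ s, realPair (x i) := by
  classical
  induction s using Finset.induction_on with
  | empty => ext i <;> simp [realPair]
  | insert a s ha ih => rw [Finset.sum_insert ha, Finset.sum_insert ha, realPair_add, ih]

/-! ### The holomorphic volume form on a frame -/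

/-- The coordinates of a pair of vectors, as a linear map. -/
def pairCoordsL : Pair n →ₗ[ℂ] (Fin (n + 1) ⊕ Fin (n + 1) → ℂ) where
  toFun := pairCoords
  map_add' x y := by ext (i | i) <;> rfl
  map_smul' c x := by ext (i | i) <;> rfl

/-- The rows of the determinant in `holVol`, with the two radial rows split off. -/
def rowEquiv (n : ℕ) : Bool ⊕ (Fin n ⊕ Fin n) ≃ Fin (n + 1) ⊕ Fin (n + 1) where
  toFun := Sum.elim (fun b => cond b (Sum.inr 0) (Sum.inl 0)) (Sum.map Fin.succ Fin.succ)
  invFun := Sum.elim (Fin.cases (Sum.inl false) fun a => Sum.inr (Sum.inl a))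
    (Fin.cases (Sum.inl true) fun a => Sum.inr (Sum.inr a))
  left_inv := by rintro ((_ | _) | (a | a)) <;> rfl
  right_inv := by
    rintro (a | a) <;> refine Fin.cases ?_ (fun a => ?_) a <;> rfl

/-- The square matrix of the coordinates of the radial vectors `(z, 0)`, `(0, w)` and of `v`. -/
def frameMatrix (z w : Hom n) (v : Fin n ⊕ Fin n → Pair n) :
    Matrix (Bool ⊕ (Fin n ⊕ Fin n)) (Bool ⊕ (Fin n ⊕ Fin n)) ℂ :=
  Matrix.of fun i j => pairCoordsL
    (Sum.elim (fun b => cond b ((0, w) : Pair n) (z, 0)) v i) (rowEquiv n j)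

lemma holVol_eq_det_frameMatrix (z w : Hom n) (v : Fin n ⊕ Fin n → Pair n) :
    holVol (z, w) v = 2 ^ n * (frameMatrix z w v).det / bdot (z, w) ^ (n + 1) := by
  rw [holVol, ← Matrix.det_submatrix_equiv_self (rowEquiv n)]
  congr 3
  ext ((_ | _) | (a | a)) j <;> rfl

lemma frameMatrix_eq_mul {z w z' w' : Hom n} {v v' : Fin n ⊕ Fin n → Pair n}
    {G : Matrix (Bool ⊕ (Fin n ⊕ Fin n)) (Bool ⊕ (Fin n ⊕ Fin n)) ℂ}
    (h : ∀ i, Sum.elim (fun b => cond b ((0, w') : Pair n) (z', 0)) v' i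
      = ∑ j, G i j • Sum.elim (fun b => cond b ((0, w) : Pair n) (z, 0)) v j) :
    frameMatrix z' w' v' = G * frameMatrix z w v := by
  ext i j
  rw [frameMatrix, Matrix.of_apply, h i, Matrix.mul_apply, map_sum, Finset.sum_apply]
  simp [frameMatrix]

/-- Interchanging the two factors of `ℂ^{n+1} × ℂ^{n+1}` in the columns and the two radial rows
has this sign. -/
def swapSign (n : ℕ) : ℂ :=
  ((Equiv.Perm.sign (((rowEquiv n).trans (Equiv.sumComm _ _)).trans (rowEquiv n).symm) : ℤ) : ℂ)
    * ((Equiv.Perm.sign (Equiv.sumCongr Equiv.boolNot (Equiv.refl (Fin n ⊕ Fin n))) : ℤ) : ℂ)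

lemma swapSign_sq (n : ℕ) : swapSign n * swapSign n = 1 := by
  have h : ∀ u : ℤˣ, ((u : ℤ) : ℂ) * ((u : ℤ) : ℂ) = 1 := fun u => by
    rw [← Int.cast_mul, ← Units.val_mul, Int.units_mul_self]
    simp
  rw [swapSign, mul_mul_mul_comm, h, h, one_mul]

/-- For an orthonormal frame the two factors are conjugate, so interchanging them computes the
square of the determinant. -/
lemma det_frameMatrix_sq {ζ : Hom n} (hζ : ‖ζ‖ = 1) {f : Fin n ⊕ Fin n → Hom n}
    (hf : Orthonormal ℝ f) (hζf : ∀ i, ⟪ζ, f i⟫_ℂ = 0) :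
    (frameMatrix ζ (conjVec ζ) fun i => realPair (f i)).det ^ 2 = swapSign n * 4 ^ n := by
  set B := frameMatrix ζ (conjVec ζ) fun i => realPair (f i) with hB
  set τ := ((rowEquiv n).trans (Equiv.sumComm _ _)).trans (rowEquiv n).symm with hτ
  set π : Equiv.Perm (Bool ⊕ (Fin n ⊕ Fin n)) :=
    Equiv.sumCongr Equiv.boolNot (Equiv.refl (Fin n ⊕ Fin n)) with hπ
  have hfζ : ∀ i, ⟪f i, ζ⟫_ℂ = 0 := fun i => inner_eq_zero_symm.1 (hζf i)
  have h1 : ∀ x y : Hom n, ∑ j, x j * (starRingEnd ℂ) (y j) = ⟪y, x⟫_ℂ := sum_mul_conjVec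
  have h2 : ∀ x y : Hom n, ∑ j, (starRingEnd ℂ) (x j) * y j = ⟪x, y⟫_ℂ := fun x y => by
    rw [← sum_mul_conjVec]; exact Finset.sum_congr rfl fun j _ => mul_comm _ _
  have hff : ∀ i j, ⟪f j, f i⟫_ℂ + ⟪f i, f j⟫_ℂ = if i = j then 2 else 0 := by
    intro i j
    rw [← inner_conj_symm (f j) (f i), add_comm, Complex.add_conj, ← real_inner_eq_re,
      orthonormal_iff_ite.1 hf]
    split_ifs <;> simp
  have hprod : B * (B.submatrix π τ).transpose
      = Matrix.diagonal (Sum.elim (fun _ => 1) fun _ => 2) := by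
    ext i j
    rw [Matrix.mul_apply]
    simp only [Matrix.transpose_apply, Matrix.submatrix_apply]
    rw [← Equiv.sum_comp (rowEquiv n).symm, Fintype.sum_sum_type]
    rcases i with (_ | _) | i <;> rcases j with (_ | _) | j <;>
      simp [hB, frameMatrix, hτ, hπ, pairCoordsL, pairCoords, realPair, Matrix.diagonal_apply,
        h1, h2, hζ, hζf, hfζ, hff]
  have hdet := congrArg Matrix.det hprod
  have hsub : (B.submatrix π τ).det = swapSign n * B.det := by
    have : B.submatrix π τ = (B.submatrix id τ).submatrix π id := rfl
    rw [this, Matrix.det_permute, Matrix.det_permute', swapSign]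
    ring
  rw [Matrix.det_mul, Matrix.det_transpose, hsub, Matrix.det_diagonal] at hdet
  have h4 : (∏ i : Bool ⊕ (Fin n ⊕ Fin n), Sum.elim (fun _ => (1 : ℂ)) (fun _ => 2) i)
      = 4 ^ n := by
    rw [Fintype.prod_sum_type]
    simp
    rw [← two_mul, pow_mul]
    norm_num
  rw [h4] at hdet
  rw [← hdet]
  linear_combination (-B.det ^ 2) * swapSign_sq n

/-- The value of `holVol` on vectors with coefficients `Y` in an orthonormal frame, modulo the
radial vectors. The constant `κ` gives its phase. -/
theorem exists_holVol_eq_det (n : ℕ) : ∃ κ : ℂ, ‖κ‖ = 1 ∧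
    ∀ (ζ : Hom n) (f : Fin n ⊕ Fin n → Hom n), ‖ζ‖ = 1 → Orthonormal ℝ f →
      (∀ i, ⟪ζ, f i⟫_ℂ = 0) → ∃ σ : ℝ, σ ≠ 0 ∧
        ∀ (z w : Hom n) (c : ℂ) (α β a b : Fin n ⊕ Fin n → ℂ)
          (Y : Matrix (Fin n ⊕ Fin n) (Fin n ⊕ Fin n) ℂ) (v : Fin n ⊕ Fin n → Pair n),
          ((z, 0) : Pair n) = c • ((ζ, 0) : Pair n) + ∑ i, α i • realPair (f i) →
          ((0, w) : Pair n) = c • ((0, conjVec ζ) : Pair n) + ∑ i, β i • realPair (f i) →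
          (∀ j, v j = a j • ((z, 0) : Pair n) + b j • ((0, w) : Pair n)
            + ∑ i, Y j i • realPair (f i)) →
          holVol (z, w) v = σ * κ * c ^ 2 * Y.det / bdot (z, w) ^ (n + 1) := by
  obtain ⟨κ, hκ⟩ := IsAlgClosed.exists_pow_nat_eq (swapSign n) (n := 2) (by norm_num)
  have hκ1 : ‖κ‖ = 1 := by
    have h1 : κ ^ 4 = 1 := by
      rw [show κ ^ 4 = κ ^ 2 * κ ^ 2 by ring, hκ, swapSign_sq]
    exact Complex.norm_eq_one_of_pow_eq_one h1 (by norm_num)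
  refine ⟨κ, hκ1, fun ζ f hζ hf hζf => ?_⟩
  set B := frameMatrix ζ (conjVec ζ) fun i => realPair (f i) with hB
  have hdetB : ∃ σ : ℝ, σ ≠ 0 ∧ B.det = σ * κ := by
    have h1 : B.det ^ 2 = ((2 : ℂ) ^ n * κ) ^ 2 := by
      rw [det_frameMatrix_sq hζ hf hζf, mul_pow, hκ, ← pow_mul, mul_comm n 2, pow_mul]
      norm_num
      ring
    rcases sq_eq_sq_iff_eq_or_eq_neg.1 h1 with h | h
    · exact ⟨2 ^ n, by positivity, by rw [h]; push_cast; ring⟩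
    · exact ⟨-2 ^ n, neg_ne_zero.2 (by positivity), by rw [h]; push_cast; ring⟩
  obtain ⟨σ, hσ, hBσ⟩ := hdetB
  refine ⟨2 ^ n * σ, mul_ne_zero (by positivity) hσ, fun z w c α β a b Y v hz hw hv => ?_⟩
  have h1 : frameMatrix z w (fun i => realPair (f i))
      = Matrix.fromBlocks (Matrix.diagonal fun _ => c) (Matrix.of fun b i => cond b (β i) (α i))
        0 1 * B := by
    refine frameMatrix_eq_mul ?_
    rintro ((_ | _) | i)
    · simp [Fintype.sum_sum_type, hz]
    · simp [Fintype.sum_sum_type, hw]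
    · simp [Fintype.sum_sum_type, Matrix.one_apply]
  have h2 : frameMatrix z w v
      = Matrix.fromBlocks 1 0 (Matrix.of fun j x => cond x (b j) (a j)) Y
        * frameMatrix z w (fun i => realPair (f i)) := by
    refine frameMatrix_eq_mul ?_
    rintro ((_ | _) | i)
    · simp [Fintype.sum_sum_type, Matrix.one_apply]
    · simp [Fintype.sum_sum_type, Matrix.one_apply]
    · simp only [Fintype.sum_sum_type, Sum.elim_inr, hv i]
      simp [add_comm]
  rw [holVol_eq_det_frameMatrix, h2, h1, Matrix.det_mul, Matrix.det_mul,
    Matrix.det_fromBlocks_zero₁₂, Matrix.det_fromBlocks_zero₂₁, hBσ]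
  simp
  ring

/-! ### The Kähler potential -/

lemma exhaustion_eq (q : Pair n) :
    exhaustion q = ‖q.1‖ ^ 2 * ‖q.2‖ ^ 2 / ‖bdot q‖ ^ 2 := by
  rw [exhaustion, EuclideanSpace.norm_sq_eq, EuclideanSpace.norm_sq_eq, Finset.sum_mul_sum]
  simp [mul_pow]

lemma contDiff_bdot : ContDiff ℝ 2 (bdot (n := n)) := by
  unfold bdot
  fun_prop

lemma contDiffAt_potential {q : Pair n} (h1 : q.1 ≠ 0) (h2 : q.2 ≠ 0) (h : bdot q ≠ 0) :
    ContDiffAt ℝ 2 potential q := by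
  have hN : ContDiffAt ℝ 2 (exhaustion (n := n)) q := by
    rw [funext exhaustion_eq]
    refine ContDiffAt.div ?_ (contDiff_bdot.contDiffAt.norm_sq ℂ) (by simpa using h)
    exact (contDiffAt_fst.norm_sq ℂ).mul (contDiffAt_snd.norm_sq ℂ)
  have hne : exhaustion q ≠ 0 := by
    rw [exhaustion_eq]
    simp [h1, h2, h]
  exact contDiffAt_const.mul (hN.sqrt hne)

/-- The potential is stationary in directions in which `z · w` and `|z| |w|` are. -/
lemma fderiv_potential_eq_zero {q d : Pair n} (h1 : q.1 ≠ 0) (h12 : ‖q.1‖ = ‖q.2‖)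
    (h : bdot q ≠ 0) (hd : ⟪q.1, d.1⟫_ℝ + ⟪q.2, d.2⟫_ℝ = 0)
    (hb : ∑ j, (d.1 j * q.2 j + q.1 j * d.2 j) = 0) :
    fderiv ℝ potential q d = 0 := by
  have h2 : q.2 ≠ 0 := by rw [← norm_ne_zero_iff, ← h12]; exact norm_ne_zero_iff.2 h1
  have hline : ∀ x y : Hom n, HasDerivAt (fun s : ℝ => x + s • y) y 0 := fun x y => by
    simpa using ((hasDerivAt_id (0 : ℝ)).smul_const y).const_add x
  have hcoord : ∀ (x y : Hom n) j, HasDerivAt (fun s : ℝ => (x + s • y) j) (y j) 0 := by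
    intro x y j
    exact ((EuclideanSpace.proj j : Hom n →L[ℂ] ℂ).restrictScalars ℝ).hasFDerivAt.comp_hasDerivAt
      (0 : ℝ) (hline x y)
  have hbd : HasDerivAt (fun s : ℝ => bdot (q + s • d)) 0 0 := by
    rw [← hb]
    unfold bdot
    refine HasDerivAt.fun_sum fun j _ => ?_
    have := (hcoord q.1 d.1 j).fun_mul (hcoord q.2 d.2 j)
    simp only [zero_smul, add_zero] at this
    exact this
  have hN : HasDerivAt (fun s : ℝ => exhaustion (q + s • d)) 0 0 := by
    simp_rw [exhaustion_eq]
    have := (((hline q.1 d.1).norm_sq).mul ((hline q.2 d.2).norm_sq)).div hbd.norm_sq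
      (by simpa using h)
    convert! this using 1
    simp
    rw [← h12, eq_comm, div_eq_zero_iff]
    left
    linear_combination (2 * ‖q.1‖ ^ 2 * ‖bdot q‖ ^ 2) * hd
  have hne : exhaustion q ≠ 0 := by
    rw [exhaustion_eq]
    simp [h1, h2, h]
  have hp : HasDerivAt (fun s : ℝ => potential (q + s • d)) 0 0 := by
    convert! (hN.sqrt (by simpa using hne)).const_mul 2 using 1
    simp
  have hl : HasDerivAt (fun s : ℝ => q + s • d) d 0 := by
    simpa using ((hasDerivAt_id (0 : ℝ)).smul_const d).const_add q
  have hf : HasFDerivAt potential (fderiv ℝ potential q) (q + (0 : ℝ) • d) := by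
    simpa using ((contDiffAt_potential h1 h2 h).differentiableAt (by norm_num)).hasFDerivAt
  have hc := hf.comp_hasDerivAt (f := fun s : ℝ => q + s • d) (0 : ℝ) hl
  exact hc.unique hp

end

section

variable {n k : ℕ}

/-! ### Geometry of a lift -/

/-- `z` is smooth near `x` with values in the unit sphere. -/
structure IsUnitLift (z : Coord k → Hom n) (x : Coord k) : Prop where
  eventually_contDiffAt : ∀ᶠ y in 𝓝 x, ContDiffAt ℝ ∞ z y
  norm_eq : ∀ᶠ y in 𝓝 x, ‖z y‖ = 1

lemma IsLiftAt.isUnitLift {M : Type*} [TopologicalSpace M] [ChartedSpace (Coord k) M]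
    {F : M → Projectivization ℂ (Hom n)} {p : M} {z : Coord k → Hom n} (h : IsLiftAt F p z) :
    IsUnitLift z (chartPt k p) := by
  obtain ⟨U, hU, hx, hz, hn⟩ := h
  exact ⟨Filter.eventually_of_mem (hU.mem_nhds hx) fun y hy => hz.contDiffAt (hU.mem_nhds hy),
    Filter.eventually_of_mem (hU.mem_nhds hx) fun y hy => (hn y hy).1⟩

lemma hproj_apply {ζ : Hom n} (hζ : ‖ζ‖ = 1) (v : Hom n) :
    hproj ζ v = v - ⟪ζ, v⟫_ℂ • ζ := by
  have : hproj ζ v = (ℂ ∙ ζ)ᗮ.starProjection v := rfl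
  rw [this, Submodule.starProjection_orthogonal_val, Submodule.starProjection_unit_singleton ℂ hζ]

lemma inner_hproj_left {ζ ν : Hom n} (hζ : ‖ζ‖ = 1) (hν : ⟪ζ, ν⟫_ℂ = 0) (v : Hom n) :
    ⟪hproj ζ v, ν⟫_ℂ = ⟪v, ν⟫_ℂ := by
  rw [hproj_apply hζ, inner_sub_left, inner_smul_left, hν, mul_zero, sub_zero]

lemma inner_hproj_self {ζ : Hom n} (hζ : ‖ζ‖ = 1) (v : Hom n) : ⟪ζ, hproj ζ v⟫_ℂ = 0 := by
  rw [hproj_apply hζ, inner_sub_right, inner_smul_right, inner_self_eq_norm_sq_to_K, hζ]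
  simp

namespace IsUnitLift

variable {z : Coord k → Hom n} {x : Coord k}

lemma eventually (h : IsUnitLift z x) : ∀ᶠ y in 𝓝 x, IsUnitLift z y := by
  filter_upwards [h.eventually_contDiffAt.eventually_nhds, h.norm_eq.eventually_nhds] with y h1 h2
  exact ⟨h1, h2⟩

lemma contDiffAt (h : IsUnitLift z x) : ContDiffAt ℝ ∞ z x :=
  h.eventually_contDiffAt.self_of_nhds

lemma norm_self (h : IsUnitLift z x) : ‖z x‖ = 1 := h.norm_eq.self_of_nhds

lemma differentiableAt (h : IsUnitLift z x) : DifferentiableAt ℝ z x :=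
  h.contDiffAt.differentiableAt (by simp)

lemma re_inner_fderiv (h : IsUnitLift z x) (u : Coord k) : (⟪z x, fderiv ℝ z x u⟫_ℂ).re = 0 := by
  have h1 := (h.differentiableAt.hasFDerivAt.inner ℝ h.differentiableAt.hasFDerivAt)
  have h2 : (fun y => ⟪z y, z y⟫_ℝ) =ᶠ[𝓝 x] fun _ => 1 := by
    filter_upwards [h.norm_eq] with y hy
    rw [real_inner_self_eq_norm_sq, hy, one_pow]
  have h3 := (h1.congr_of_eventuallyEq h2.symm).unique (hasFDerivAt_const (1 : ℝ) x)
  have h4 := congrArg (fun A => A u) h3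
  simp [real_inner_comm] at h4
  rw [← real_inner_eq_re]
  linarith

lemma hderiv_apply (h : ‖z x‖ = 1) (u : Coord k) :
    hderiv z x u = fderiv ℝ z x u - ⟪z x, fderiv ℝ z x u⟫_ℂ • z x := hproj_apply h _

lemma inner_hderiv (h : ‖z x‖ = 1) (u : Coord k) : ⟪z x, hderiv z x u⟫_ℂ = 0 :=
  inner_hproj_self h _

lemma contDiffAt_hderiv (h : IsUnitLift z x) (v : Coord k) :
    ContDiffAt ℝ ∞ (fun y => hderiv z y v) x := by
  have h1 : ContDiffAt ℝ ∞ (fun y => fderiv ℝ z y v) x :=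
    (h.contDiffAt.fderiv_right (m := ∞) (by simp)).clm_apply contDiffAt_const
  have h2 : (fun y => hderiv z y v) =ᶠ[𝓝 x]
      fun y => fderiv ℝ z y v - ⟪z y, fderiv ℝ z y v⟫_ℂ • z y := by
    filter_upwards [h.norm_eq] with y hy using hderiv_apply hy v
  exact (h1.sub ((h.contDiffAt.inner ℂ h1).smul h.contDiffAt)).congr_of_eventuallyEq h2

end IsUnitLift

lemma IsNormal.inner_hderiv {z : Coord k → Hom n} {x : Coord k} {ν : Hom n}
    (h : IsNormal z x ν) (u : Coord k) : ⟪hderiv z x u, ν⟫_ℝ = 0 := h.2 _ ⟨u, rfl⟩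

lemma isNormal_iff {z : Coord k → Hom n} {x : Coord k} {ν : Hom n} :
    IsNormal z x ν ↔ ⟪z x, ν⟫_ℂ = 0 ∧ ∀ u, ⟪hderiv z x u, ν⟫_ℝ = 0 := by
  constructor
  · exact fun h => ⟨h.1, h.inner_hderiv⟩
  · rintro ⟨h1, h2⟩
    refine ⟨h1, ?_⟩
    rintro _ ⟨u, rfl⟩
    exact h2 u

/-! ### The second fundamental form -/

section SecondFF

variable {z : Coord k → Hom n} {x : Coord k} {ν : Hom n}

lemma IsNormal.inner_hderiv_eq (hν : IsNormal z x ν) (u : Coord k) :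
    ⟪hderiv z x u, ν⟫_ℂ = -(⟪hderiv z x u, J ν⟫_ℝ : ℂ) * Complex.I := by
  apply Complex.ext
  · rw [← real_inner_eq_re, hν.inner_hderiv]; simp
  · rw [inner_J_right]; simp

lemma secondFF_eq (h : IsUnitLift z x) (hν : IsNormal z x ν) (u v : Coord k) :
    secondFF z x ν u v = ⟪fderiv ℝ (fun y => hderiv z y v) x u, ν⟫_ℝ
      + (⟪z x, fderiv ℝ z x u⟫_ℂ).im * ⟪hderiv z x v, J ν⟫_ℝ := by
  rw [secondFF, covDeriv, inner_sub_left, real_inner_eq_re, inner_hproj_left h.norm_self hν.1,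
    ← real_inner_eq_re, real_inner_eq_re (_ • _), inner_smul_left, hν.inner_hderiv_eq]
  have := h.re_inner_fderiv u
  have hre : (⟪fderiv ℝ z x u, z x⟫_ℂ).re = 0 := by
    rw [← inner_conj_symm, Complex.conj_re, this]
  have him : (⟪fderiv ℝ z x u, z x⟫_ℂ).im = -(⟪z x, fderiv ℝ z x u⟫_ℂ).im := by
    rw [← inner_conj_symm, Complex.conj_im]
  simp [Complex.mul_re, hre, him]

lemma secondFF_eq_sndFDeriv (h : IsUnitLift z x) (hν : IsNormal z x ν) (u v : Coord k) :
    secondFF z x ν u v = ⟪fderiv ℝ (fderiv ℝ z) x u v, ν⟫_ℝ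
      + (⟪z x, fderiv ℝ z x v⟫_ℂ).im * ⟪fderiv ℝ z x u, J ν⟫_ℝ
      + (⟪z x, fderiv ℝ z x u⟫_ℂ).im * ⟪fderiv ℝ z x v, J ν⟫_ℝ := by
  have h1 : HasFDerivAt (fderiv ℝ z) (fderiv ℝ (fderiv ℝ z) x) x :=
    ((h.contDiffAt.fderiv_right (m := ∞) (by simp)).differentiableAt (by simp)).hasFDerivAt
  have h2 : HasDerivAt (fun s : ℝ => x + s • u) u 0 := by
    simpa using ((hasDerivAt_id (0 : ℝ)).smul_const u).const_add x
  have hz : HasDerivAt (fun s : ℝ => z (x + s • u)) (fderiv ℝ z x u) 0 :=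
    h.differentiableAt.hasFDerivAt.hasLineDerivAt u
  have hv : HasDerivAt (fun s : ℝ => fderiv ℝ z (x + s • u) v) (fderiv ℝ (fderiv ℝ z) x u v) 0 := by
    have h3 : HasDerivAt (fun s : ℝ => fderiv ℝ z (x + s • u)) (fderiv ℝ (fderiv ℝ z) x u) 0 :=
      h1.hasLineDerivAt u
    simpa using h3.clm_apply (hasDerivAt_const (0 : ℝ) v)
  have hX : HasDerivAt (fun s : ℝ => hderiv z (x + s • u) v)
      (fderiv ℝ (fun y => hderiv z y v) x u) 0 :=
    ((h.contDiffAt_hderiv v).differentiableAt (by simp)).hasFDerivAt.hasLineDerivAt u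
  have hev : (fun s : ℝ => hderiv z (x + s • u) v) =ᶠ[𝓝 0] fun s : ℝ => fderiv ℝ z (x + s • u) v
      - ⟪z (x + s • u), fderiv ℝ z (x + s • u) v⟫_ℂ • z (x + s • u) := by
    have hc : Filter.Tendsto (fun s : ℝ => x + s • u) (𝓝 0) (𝓝 x) := by
      simpa using h2.continuousAt.tendsto
    filter_upwards [hc.eventually h.norm_eq] with s hs using IsUnitLift.hderiv_apply hs v
  have hX' : HasDerivAt (fun s : ℝ => hderiv z (x + s • u) v)
      (fderiv ℝ (fderiv ℝ z) x u v - (⟪z x, fderiv ℝ z x v⟫_ℂ • fderiv ℝ z x u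
        + (⟪z x, fderiv ℝ (fderiv ℝ z) x u v⟫_ℂ + ⟪fderiv ℝ z x u, fderiv ℝ z x v⟫_ℂ) • z x)) 0 := by
    refine HasDerivAt.congr_of_eventuallyEq ?_ hev
    have h4 := hv.fun_sub ((hz.inner ℂ hv).fun_smul hz)
    simpa only [zero_smul, add_zero] using h4
  rw [secondFF_eq h hν, hX.unique hX']
  rw [inner_sub_left, inner_add_left, real_inner_eq_re (_ • z x), real_inner_eq_re (_ • _),
    inner_smul_left, inner_smul_left, hν.1, IsUnitLift.hderiv_apply h.norm_self, inner_sub_left,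
    inner_J_right, inner_J_right, inner_J_right, inner_smul_left, hν.1]
  have h3 := h.re_inner_fderiv v
  have hre : (⟪fderiv ℝ z x v, z x⟫_ℂ).re = 0 := by
    rw [← inner_conj_symm, Complex.conj_re, h3]
  have him : (⟪fderiv ℝ z x v, z x⟫_ℂ).im = -(⟪z x, fderiv ℝ z x v⟫_ℂ).im := by
    rw [← inner_conj_symm, Complex.conj_im]
  simp [Complex.mul_re, hre, him]
  ring

/-- The second fundamental form in a normal direction is bilinear. -/
lemma exists_secondFF_eq (h : IsUnitLift z x) (hν : IsNormal z x ν) :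
    ∃ B : Coord k →ₗ[ℝ] Coord k →ₗ[ℝ] ℝ, (∀ u v, B u v = secondFF z x ν u v) ∧
      ∀ u v, B u v = B v u := by
  refine ⟨LinearMap.mk₂ ℝ (secondFF z x ν) ?_ ?_ ?_ ?_, fun u v => rfl, fun u v => ?_⟩
  · intro u u' v
    simp only [secondFF_eq_sndFDeriv h hν, map_add, add_apply, inner_add_left,
      inner_add_right, Complex.add_im]
    ring
  · intro c u v
    simp only [secondFF_eq_sndFDeriv h hν, map_smul, smul_apply,
      real_inner_smul_left, inner_smul_right_eq_smul, Complex.smul_im, smul_eq_mul]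
    ring
  · intro u v v'
    simp only [secondFF_eq_sndFDeriv h hν, map_add, inner_add_left,
      inner_add_right, Complex.add_im]
    ring
  · intro c u v
    simp only [secondFF_eq_sndFDeriv h hν, map_smul,
      real_inner_smul_left, inner_smul_right_eq_smul, Complex.smul_im, smul_eq_mul]
    ring
  · have hs : IsSymmSndFDerivAt ℝ z x := h.contDiffAt.isSymmSndFDerivAt (by
      simp only [minSmoothness_of_isRCLikeNormedField]
      exact WithTop.coe_le_coe.2 (le_top : (2 : ℕ∞) ≤ ⊤))
    simp only [LinearMap.mk₂_apply, secondFF_eq_sndFDeriv h hν, hs.eq u v]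
    ring

end SecondFF

/-! ### Tangent vectors of the normal bundle -/

/-- `(u, η)` is the velocity of the base point and of the normal vector along a curve in the
normal bundle through `ν`, expressed by the derivative at `ν` of the equations of the normal
bundle. -/
structure IsNormalVelocity (z : Coord k → Hom n) (x : Coord k) (ν : Hom n) (u : Coord k)
    (η : Hom n) : Prop where
  inner_self : ⟪fderiv ℝ z x u, ν⟫_ℂ + ⟪z x, η⟫_ℂ = 0
  inner_hderiv : ∀ v, ⟪hderiv z x v, η⟫_ℝ = -secondFF z x ν u v
    + (⟪z x, fderiv ℝ z x u⟫_ℂ).im * ⟪hderiv z x v, J ν⟫_ℝ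

/-- The map `PhiHat` over the unit sphere, extended smoothly to all pairs. -/
def stenzelMap (q : Pair n) : Pair n :=
  (coshSqrt (‖q.2‖ ^ 2) • q.1 + sinhcSqrt (‖q.2‖ ^ 2) • J q.2,
    coshSqrt (‖q.2‖ ^ 2) • conjVecL q.1 + sinhcSqrt (‖q.2‖ ^ 2) • J (conjVecL q.2))

lemma contDiff_J : ContDiff ℝ ∞ (J (n := n)) := contDiff_const_smul Complex.I

lemma contDiff_stenzelMap : ContDiff ℝ ∞ (stenzelMap (n := n)) := by
  have h : ContDiff ℝ ∞ fun q : Pair n => ‖q.2‖ ^ 2 := contDiff_snd.norm_sq ℂ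
  have hC : ContDiff ℝ ∞ fun q : Pair n => coshSqrt (‖q.2‖ ^ 2) := contDiff_coshSqrt.comp h
  have hS : ContDiff ℝ ∞ fun q : Pair n => sinhcSqrt (‖q.2‖ ^ 2) := contDiff_sinhcSqrt.comp h
  refine ContDiff.prodMk ?_ ?_
  · exact (hC.smul contDiff_fst).add (hS.smul (contDiff_J.comp contDiff_snd))
  · exact (hC.smul (conjVecL.contDiff.comp contDiff_fst)).add
      (hS.smul (contDiff_J.comp (conjVecL.contDiff.comp contDiff_snd)))

lemma PhiHat_eq_stenzelMap {ζ : Hom n} (hζ : ‖ζ‖ = 1) (ξ : Hom n) :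
    PhiHat ζ ξ = stenzelMap (ζ, ξ) := by
  have hs : ∀ v : Hom n, v = 0 ∨ ‖ξ‖ ≠ 0 →
      (Complex.I * ((Real.sinh ‖ξ‖ / ‖ξ‖ : ℝ) : ℂ)) • v = sinhcSqrt (‖ξ‖ ^ 2) • J v := by
    rintro v (rfl | hξ)
    · simp [J]
    · rw [← sinhcSqrt_sq_mul, mul_div_cancel_right₀ _ hξ, J, mul_comm, mul_smul]
      rfl
  have hξ : ∀ v : Hom n, ‖v‖ = ‖ξ‖ → v = 0 ∨ ‖ξ‖ ≠ 0 := fun v hv => by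
    rw [← hv, ← norm_eq_zero (a := v)]
    exact em _
  simp only [PhiHat, stenzelMap, hζ, div_one, coshSqrt_sq, conjVecL_apply]
  rw [hs _ (hξ _ rfl), hs _ (hξ _ (norm_conjVec ξ))]
  rfl

lemma bdot_stenzelMap {ζ ξ : Hom n} (hζ : ‖ζ‖ = 1) (h : ⟪ζ, ξ⟫_ℂ = 0) :
    bdot (stenzelMap (ζ, ξ)) = 1 := by
  have h' : ⟪ξ, ζ⟫_ℂ = 0 := inner_eq_zero_symm.1 h
  have e1 := sum_mul_conjVec ζ ζ
  have e2 := sum_mul_conjVec ζ ξ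
  have e3 := sum_mul_conjVec ξ ζ
  have e4 := sum_mul_conjVec ξ ξ
  rw [inner_self_eq_norm_sq_to_K, hζ] at e1
  rw [inner_self_eq_norm_sq_to_K] at e4
  rw [h'] at e2
  rw [h] at e3
  set C : ℂ := (coshSqrt (‖ξ‖ ^ 2) : ℂ) with hC
  set S : ℂ := (sinhcSqrt (‖ξ‖ ^ 2) : ℂ) with hS
  have key : bdot (stenzelMap (ζ, ξ)) = C ^ 2 * ∑ j, ζ j * conjVec ζ j
      + Complex.I * C * S * ∑ j, ζ j * conjVec ξ j + Complex.I * C * S * ∑ j, ξ j * conjVec ζ j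
      - S ^ 2 * ∑ j, ξ j * conjVec ξ j := by
    rw [bdot, Finset.mul_sum, Finset.mul_sum, Finset.mul_sum, Finset.mul_sum,
      ← Finset.sum_add_distrib, ← Finset.sum_add_distrib, ← Finset.sum_sub_distrib]
    refine Finset.sum_congr rfl fun j _ => ?_
    simp [stenzelMap, J, ← hC, ← hS]
    linear_combination (S ^ 2 * ξ j * (starRingEnd ℂ) (ξ j)) * Complex.I_sq
  rw [key, e1, e2, e3, e4, hC, hS]
  have := coshSqrt_sq_sub ‖ξ‖
  simp
  exact_mod_cast this

/-- Velocity of the image under `stenzelMap` of a curve with velocity `(a, η)` at `(ζ, ν)`. -/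
def stenzelVelocity (ζ ν a η : Hom n) : Pair n :=
  let C := coshSqrt (‖ν‖ ^ 2)
  let S := sinhcSqrt (‖ν‖ ^ 2)
  let C' := deriv coshSqrt (‖ν‖ ^ 2) * (2 * ⟪ν, η⟫_ℝ)
  let S' := deriv sinhcSqrt (‖ν‖ ^ 2) * (2 * ⟪ν, η⟫_ℝ)
  (C • a + C' • ζ + (S • J η + S' • J ν),
    C • conjVecL a + C' • conjVecL ζ + (S • J (conjVecL η) + S' • J (conjVecL ν)))

lemma hasDerivAt_stenzelMap {a ξ : ℝ → Hom n} {a' ξ' : Hom n} {s : ℝ} (ha : HasDerivAt a a' s)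
    (hξ : HasDerivAt ξ ξ' s) :
    HasDerivAt (fun s => stenzelMap (a s, ξ s)) (stenzelVelocity (a s) (ξ s) a' ξ') s := by
  have hJ : ∀ {f : ℝ → Hom n} {f' : Hom n}, HasDerivAt f f' s →
      HasDerivAt (fun s => J (f s)) (J f') s := fun hf => hf.const_smul Complex.I
  have hconj : ∀ {f : ℝ → Hom n} {f' : Hom n}, HasDerivAt f f' s →
      HasDerivAt (fun s => conjVecL (f s)) (conjVecL f') s :=
    fun hf => conjVecL.hasFDerivAt.comp_hasDerivAt s hf
  have hC : HasDerivAt (fun s => coshSqrt (‖ξ s‖ ^ 2))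
      (deriv coshSqrt (‖ξ s‖ ^ 2) * (2 * ⟪ξ s, ξ'⟫_ℝ)) s :=
    HasDerivAt.comp (h := fun s => ‖ξ s‖ ^ 2) s
      (contDiff_coshSqrt.differentiable (by simp) _).hasDerivAt hξ.norm_sq
  have hS : HasDerivAt (fun s => sinhcSqrt (‖ξ s‖ ^ 2))
      (deriv sinhcSqrt (‖ξ s‖ ^ 2) * (2 * ⟪ξ s, ξ'⟫_ℝ)) s :=
    HasDerivAt.comp (h := fun s => ‖ξ s‖ ^ 2) s
      (contDiff_sinhcSqrt.differentiable (by simp) _).hasDerivAt hξ.norm_sq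
  exact ((hC.fun_smul ha).fun_add (hS.fun_smul (hJ hξ))).prodMk
    ((hC.fun_smul (hconj ha)).fun_add (hS.fun_smul (hJ (hconj hξ))))

section Curves

variable {z : Coord k → Hom n} {x : Coord k} {ν : Hom n}

lemma isNormalVelocity_of_curve (h : IsUnitLift z x) {γ : ℝ → Coord k} {ξ : ℝ → Hom n}
    {u : Coord k} {η : Hom n} (hγ : HasDerivAt γ u 0) (hξ : HasDerivAt ξ η 0) (hγ0 : γ 0 = x)
    (hξ0 : ξ 0 = ν) (hN : ∀ᶠ s in 𝓝 (0 : ℝ), IsNormal z (γ s) (ξ s)) :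
    IsNormalVelocity z x ν u η := by
  have hν : IsNormal z x ν := by simpa [hγ0, hξ0] using hN.self_of_nhds
  have hz : HasDerivAt (fun s => z (γ s)) (fderiv ℝ z x u) 0 := by
    subst hγ0
    exact h.differentiableAt.hasFDerivAt.comp_hasDerivAt (0 : ℝ) hγ
  constructor
  · have h1 := hz.inner ℂ hξ
    have h2 : (fun s => ⟪z (γ s), ξ s⟫_ℂ) =ᶠ[𝓝 0] fun _ => 0 := hN.mono fun s hs => hs.1
    have h3 := (h1.congr_of_eventuallyEq h2.symm).unique (hasDerivAt_const (0 : ℝ) (0 : ℂ))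
    rw [hγ0, hξ0] at h3
    rw [add_comm]
    exact h3
  · intro v
    have hX : HasDerivAt (fun s => hderiv z (γ s) v) (fderiv ℝ (fun y => hderiv z y v) x u) 0 := by
      subst hγ0
      exact ((h.contDiffAt_hderiv v).differentiableAt (by simp)).hasFDerivAt.comp_hasDerivAt
        (0 : ℝ) hγ
    have h1 := hX.inner ℝ hξ
    have h2 : (fun s => ⟪hderiv z (γ s) v, ξ s⟫_ℝ) =ᶠ[𝓝 0] fun _ => 0 :=
      hN.mono fun s hs => hs.inner_hderiv v
    have h3 := (h1.congr_of_eventuallyEq h2.symm).unique (hasDerivAt_const (0 : ℝ) (0 : ℝ))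
    rw [hγ0, hξ0] at h3
    rw [secondFF_eq h hν]
    linarith

lemma stenzelVelocity_of_isTangentAt (h : IsUnitLift z x) {w : Pair n}
    (hw : IsTangentAt z x ν w) : ∃ u η, IsNormalVelocity z x ν u η ∧
      w = stenzelVelocity (z x) ν (fderiv ℝ z x u) η := by
  obtain ⟨γ, ξ, hγ, hξ, hγ0, hξ0, hN, hd⟩ := hw
  have hγ' := (hγ.differentiableAt (by simp)).hasDerivAt
  have hξ' := (hξ.differentiableAt (by simp)).hasDerivAt
  refine ⟨_, _, isNormalVelocity_of_curve h hγ' hξ' hγ0 hξ0 hN, ?_⟩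
  have hz : HasDerivAt (fun s => z (γ s)) (fderiv ℝ z x (deriv γ 0)) 0 := by
    subst hγ0
    exact h.differentiableAt.hasFDerivAt.comp_hasDerivAt (0 : ℝ) hγ'
  have h1 := hasDerivAt_stenzelMap hz hξ'
  have h2 : (fun s => PhiHat (z (γ s)) (ξ s)) =ᶠ[𝓝 0] fun s => stenzelMap (z (γ s), ξ s) := by
    have hc : Filter.Tendsto γ (𝓝 0) (𝓝 x) := hγ0 ▸ hγ.continuousAt.tendsto
    filter_upwards [hc.eventually h.norm_eq] with s hs using PhiHat_eq_stenzelMap hs _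
  have h3 := (hd.congr_of_eventuallyEq h2.symm).unique h1
  rw [h3, hγ0, hξ0]

end Curves

end

section

variable {n k : ℕ}

/-! ### Smooth sections of the normal bundle -/

/-- A real frame of the orthogonal complement of the normal space: the lift `z`, the vertical
direction `i z`, and the coordinate vectors. -/
def conormalFrame (z : Coord k → Hom n) : Bool ⊕ Fin k → Coord k → Hom n :=
  Sum.elim (fun b y => cond b (J (z y)) (z y))
    fun i y => hderiv z y (EuclideanSpace.basisFun (Fin k) ℝ i)

lemma inner_J_left (x y : Hom n) : ⟪J x, y⟫_ℝ = (⟪x, y⟫_ℂ).im := by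
  rw [real_inner_eq_re, J, inner_smul_left]
  simp

lemma isNormal_iff_conormalFrame {z : Coord k → Hom n} {x : Coord k} {ν : Hom n} :
    IsNormal z x ν ↔ ∀ i, ⟪conormalFrame z i x, ν⟫_ℝ = 0 := by
  rw [isNormal_iff]
  constructor
  · rintro ⟨h1, h2⟩ ((_ | _) | i)
    · simp [conormalFrame, real_inner_eq_re, h1]
    · simp [conormalFrame, inner_J_left, h1]
    · exact h2 _
  · intro h
    refine ⟨Complex.ext ?_ ?_, fun u => ?_⟩
    · simpa [conormalFrame, real_inner_eq_re] using h (Sum.inl false)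
    · simpa [conormalFrame, inner_J_left] using h (Sum.inl true)
    · rw [← (EuclideanSpace.basisFun (Fin k) ℝ).sum_repr u, map_sum, sum_inner]
      refine Finset.sum_eq_zero fun i _ => ?_
      rw [map_smul, real_inner_smul_left]
      exact mul_eq_zero_of_right _ (h (Sum.inr i))

lemma hasDerivAt_add_smul {E : Type*} [NormedAddCommGroup E] [NormedSpace ℝ E] (x u : E) :
    HasDerivAt (fun s : ℝ => x + s • u) u 0 := by
  simpa using ((hasDerivAt_id (0 : ℝ)).smul_const u).const_add x

section NormalProj

variable {z : Coord k → Hom n} {x : Coord k} {ν : Hom n}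

lemma IsUnitLift.contDiffAt_conormalFrame (h : IsUnitLift z x) (i : Bool ⊕ Fin k) :
    ContDiffAt ℝ ∞ (conormalFrame z i) x := by
  rcases i with (_ | _) | i
  · exact h.contDiffAt
  · exact contDiff_J.contDiffAt.comp x h.contDiffAt
  · exact h.contDiffAt_hderiv _

lemma linearIndependent_conormalFrame (h : ‖z x‖ = 1) (hinj : Function.Injective (hderiv z x)) :
    LinearIndependent ℝ fun i => conormalFrame z i x := by
  rw [Fintype.linearIndependent_iff]
  intro g hg
  set u : Coord k := ∑ i, g (Sum.inr i) • EuclideanSpace.basisFun (Fin k) ℝ i with hu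
  have h1 : ((g (Sum.inl false) : ℂ) + g (Sum.inl true) * Complex.I) • z x + hderiv z x u = 0 := by
    rw [Fintype.sum_sum_type, Fintype.sum_bool] at hg
    rw [← hg, hu, map_sum]
    simp only [conormalFrame, Sum.elim_inl, Sum.elim_inr, cond_true, cond_false, map_smul, J,
      add_smul, mul_smul, Complex.coe_smul]
    abel
  have h2 : (g (Sum.inl false) : ℂ) + g (Sum.inl true) * Complex.I = 0 := by
    have := congrArg (fun v => ⟪z x, v⟫_ℂ) h1
    simp only [inner_add_right, inner_smul_right, IsUnitLift.inner_hderiv h,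
      inner_self_eq_norm_sq_to_K, h, inner_zero_right] at this
    simpa using this
  have h3 : u = 0 := by
    rw [h2, zero_smul, zero_add] at h1
    exact hinj (by rw [h1, map_zero])
  rintro ((_ | _) | i)
  · simpa using congrArg Complex.re h2
  · simpa using congrArg Complex.im h2
  · have := congrArg (fun v => v i) h3
    simpa [hu, EuclideanSpace.basisFun_apply, Finset.sum_apply, Pi.single_apply] using this

lemma exists_normalProj (h : IsUnitLift z x) (hinj : Function.Injective (hderiv z x)) :
    ∃ P : Coord k → Hom n →L[ℝ] Hom n, ContDiffAt ℝ ∞ P x ∧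
      ∀ᶠ y in 𝓝 x, (∀ v, IsNormal z y (P y v)) ∧ ∀ ν, IsNormal z y ν → P y ν = ν := by
  obtain ⟨P, hP, hev⟩ := exists_contDiffAt_proj (m := ∞) h.contDiffAt_conormalFrame
    (linearIndependent_conormalFrame h.norm_self hinj)
  refine ⟨P, hP, hev.mono fun y hy => ⟨fun v => ?_, fun ν hν => ?_⟩⟩
  · exact isNormal_iff_conormalFrame.2 fun i => hy.1 i v
  · exact hy.2 ν (isNormal_iff_conormalFrame.1 hν)

/-- The normal bundle has tangent vectors over every direction of the base, and every normal
vector is the velocity of a curve in the fibre. -/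
lemma exists_isTangentAt (h : IsUnitLift z x) (hinj : Function.Injective (hderiv z x))
    (hν : IsNormal z x ν) (u : Coord k) {η₀ : Hom n} (hη₀ : IsNormal z x η₀) :
    ∃ η, IsNormalVelocity z x ν u η ∧
      IsTangentAt z x ν (stenzelVelocity (z x) ν (fderiv ℝ z x u) η) ∧ (u = 0 → η = η₀) := by
  obtain ⟨P, hP, hev⟩ := exists_normalProj h hinj
  have hPx := hev.self_of_nhds
  set γ : ℝ → Coord k := fun s => x + s • u with hγdef
  set ξ : ℝ → Hom n := fun s => P (γ s) (ν + s • η₀) with hξdef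
  have hγ0 : γ 0 = x := by simp [γ]
  have hξ0 : ξ 0 = ν := by simp [ξ, hγ0, hPx.2 ν hν]
  have hγs : ContDiffAt ℝ ∞ γ 0 := by
    exact contDiffAt_const.add (contDiffAt_id.smul contDiffAt_const)
  have hξs : ContDiffAt ℝ ∞ ξ 0 := by
    have h1 : ContDiffAt ℝ ∞ (fun s => P (γ s)) 0 :=
      ContDiffAt.comp (0 : ℝ) (by rw [hγ0]; exact hP) hγs
    exact h1.clm_apply (contDiffAt_const.add (contDiffAt_id.smul contDiffAt_const))
  have hγ' : HasDerivAt γ u 0 := hasDerivAt_add_smul x u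
  have hξ' : HasDerivAt ξ (fderiv ℝ P x u ν + P x η₀) 0 := by
    have h1 : HasDerivAt (fun s => P (γ s)) (fderiv ℝ P x u) 0 :=
      (hP.differentiableAt (by simp)).hasFDerivAt.hasLineDerivAt u
    have h3 := h1.clm_apply (hasDerivAt_add_smul ν η₀)
    simp only [hγ0, zero_smul, add_zero] at h3
    exact h3
  have hc : Filter.Tendsto γ (𝓝 0) (𝓝 x) := hγ0 ▸ hγs.continuousAt.tendsto
  have hN : ∀ᶠ s in 𝓝 (0 : ℝ), IsNormal z (γ s) (ξ s) :=
    (hc.eventually hev).mono fun s hs => hs.1 _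
  refine ⟨fderiv ℝ P x u ν + P x η₀, isNormalVelocity_of_curve h hγ' hξ' hγ0 hξ0 hN,
    ⟨γ, ξ, hγs, hξs, hγ0, hξ0, hN, ?_⟩, ?_⟩
  · have hz : HasDerivAt (fun s => z (γ s)) (fderiv ℝ z x u) 0 :=
      h.differentiableAt.hasFDerivAt.hasLineDerivAt u
    have h1 := hasDerivAt_stenzelMap hz hξ'
    rw [hγ0, hξ0] at h1
    refine h1.congr_of_eventuallyEq ?_
    filter_upwards [hc.eventually h.norm_eq] with s hs using PhiHat_eq_stenzelMap hs _
  · rintro rfl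
    simp [hPx.2 η₀ hη₀]

/-! ### The normal bundle is Lagrangian -/

lemma im_inner_stenzel {ζ ν a η : Hom n} (hζν : ⟪ζ, ν⟫_ℂ = 0) (C S C' S' : ℝ) :
    (⟪C • ζ + S • J ν, C • a + C' • ζ + (S • J η + S' • J ν)⟫_ℂ).im
      = C ^ 2 * (⟪ζ, a⟫_ℂ).im + C * S * ((⟪ζ, η⟫_ℂ).re - (⟪ν, a⟫_ℂ).re)
        + S ^ 2 * (⟪ν, η⟫_ℂ).im := by
  have hνζ : ⟪ν, ζ⟫_ℂ = 0 := inner_eq_zero_symm.1 hζν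
  have hs : ∀ (c : ℝ) (v : Hom n), c • v = (c : ℂ) • v := fun c v => rfl
  simp only [hs, J, inner_add_left, inner_add_right, inner_smul_left, inner_smul_right, hζν, hνζ,
    inner_self_eq_norm_sq_to_K]
  simp [pow_two]
  ring

lemma norm_sq_stenzel {ζ ν : Hom n} (hζν : ⟪ζ, ν⟫_ℂ = 0) (C S : ℝ) :
    ‖C • ζ + S • J ν‖ ^ 2 = C ^ 2 * ‖ζ‖ ^ 2 + S ^ 2 * ‖ν‖ ^ 2 := by
  have h : ⟪C • ζ, S • J ν⟫_ℝ = 0 := by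
    rw [real_inner_smul_left, real_inner_smul_right, inner_J_right, hζν]
    simp
  rw [norm_add_sq_real, h, norm_smul, norm_smul, J, norm_smul]
  simp [mul_pow]

lemma fderiv_bdot (q d : Pair n) :
    fderiv ℝ bdot q d = ∑ j, (d.1 j * q.2 j + q.1 j * d.2 j) := by
  set p : Fin (n + 1) → Hom n →L[ℝ] ℂ := fun j =>
    (EuclideanSpace.proj j : Hom n →L[ℂ] ℂ).restrictScalars ℝ with hp
  have h1 : ∀ j, HasFDerivAt (fun q : Pair n => q.1 j)
      ((p j).comp (ContinuousLinearMap.fst ℝ (Hom n) (Hom n))) q := fun j =>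
    ((p j).comp (ContinuousLinearMap.fst ℝ (Hom n) (Hom n))).hasFDerivAt
  have h2 : ∀ j, HasFDerivAt (fun q : Pair n => q.2 j)
      ((p j).comp (ContinuousLinearMap.snd ℝ (Hom n) (Hom n))) q := fun j =>
    ((p j).comp (ContinuousLinearMap.snd ℝ (Hom n) (Hom n))).hasFDerivAt
  have h3 : HasFDerivAt (bdot (n := n)) _ q :=
    HasFDerivAt.fun_sum (u := Finset.univ) fun j _ => (h1 j).mul (h2 j)
  rw [h3.fderiv]
  simp [hp, mul_comm, add_comm]

/-- The one-form `Df ∘ i` vanishes on the normal bundle, because normal vectors are orthogonal to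
the velocity of the base point. -/
lemma fderiv_potential_stenzelVelocity (h : IsUnitLift z x) (hν : IsNormal z x ν) {u : Coord k}
    {η : Hom n} (hη : IsNormalVelocity z x ν u η)
    (hb : fderiv ℝ bdot (stenzelMap (z x, ν)) (stenzelVelocity (z x) ν (fderiv ℝ z x u) η) = 0) :
    fderiv ℝ potential (stenzelMap (z x, ν))
      (Complex.I • stenzelVelocity (z x) ν (fderiv ℝ z x u) η) = 0 := by
  have hνζ : ⟪ν, z x⟫_ℂ = 0 := inner_eq_zero_symm.1 hν.1
  have hre : (⟪fderiv ℝ z x u, ν⟫_ℂ).re = 0 := by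
    have h1 := hν.inner_hderiv u
    rw [IsUnitLift.hderiv_apply h.norm_self, real_inner_eq_re, inner_sub_left, inner_smul_left,
      hν.1, mul_zero, sub_zero] at h1
    exact h1
  have hre1 : (⟪ν, fderiv ℝ z x u⟫_ℂ).re = 0 := by
    rw [← inner_conj_symm, Complex.conj_re, hre]
  have hre2 : (⟪z x, η⟫_ℂ).re = 0 := by
    have := congrArg Complex.re hη.inner_self
    simpa [hre] using this
  have hcζν : ⟪conjVecL (z x), conjVecL ν⟫_ℂ = 0 := by
    simp only [conjVecL_apply, inner_conjVec, hνζ]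
  have hn1 := norm_sq_stenzel hν.1 (coshSqrt (‖ν‖ ^ 2)) (sinhcSqrt (‖ν‖ ^ 2))
  have hn2 := norm_sq_stenzel hcζν (coshSqrt (‖ν‖ ^ 2)) (sinhcSqrt (‖ν‖ ^ 2))
  simp only [conjVecL_apply, norm_conjVec] at hn2
  have hpos : 0 < coshSqrt (‖ν‖ ^ 2) ^ 2 * ‖z x‖ ^ 2 + sinhcSqrt (‖ν‖ ^ 2) ^ 2 * ‖ν‖ ^ 2 := by
    have := coshSqrt_sq_pos ‖ν‖
    rw [h.norm_self]
    positivity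
  refine fderiv_potential_eq_zero ?_ ?_ ?_ ?_ ?_
  · intro h0
    have : ‖(stenzelMap (z x, ν)).1‖ ^ 2 = 0 := by rw [h0]; simp
    exact hpos.ne' (hn1.symm.trans this)
  · rw [← sq_eq_sq₀ (norm_nonneg _) (norm_nonneg _)]
    exact hn1.trans hn2.symm
  · rw [bdot_stenzelMap h.norm_self hν.1]
    exact one_ne_zero
  · have e1 := inner_J_right (stenzelMap (z x, ν)).1
      (stenzelVelocity (z x) ν (fderiv ℝ z x u) η).1
    have e2 := inner_J_right (stenzelMap (z x, ν)).2
      (stenzelVelocity (z x) ν (fderiv ℝ z x u) η).2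
    have i1 := im_inner_stenzel (a := fderiv ℝ z x u) (η := η) hν.1 (coshSqrt (‖ν‖ ^ 2))
      (sinhcSqrt (‖ν‖ ^ 2)) (deriv coshSqrt (‖ν‖ ^ 2) * (2 * ⟪ν, η⟫_ℝ))
      (deriv sinhcSqrt (‖ν‖ ^ 2) * (2 * ⟪ν, η⟫_ℝ))
    have i2 := im_inner_stenzel (a := conjVecL (fderiv ℝ z x u)) (η := conjVecL η) hcζν
      (coshSqrt (‖ν‖ ^ 2)) (sinhcSqrt (‖ν‖ ^ 2)) (deriv coshSqrt (‖ν‖ ^ 2) * (2 * ⟪ν, η⟫_ℝ))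
      (deriv sinhcSqrt (‖ν‖ ^ 2) * (2 * ⟪ν, η⟫_ℝ))
    have j1 : (⟪fderiv ℝ z x u, z x⟫_ℂ).im = -(⟪z x, fderiv ℝ z x u⟫_ℂ).im := by
      rw [← inner_conj_symm, Complex.conj_im]
    have j2 : (⟪η, ν⟫_ℂ).im = -(⟪ν, η⟫_ℂ).im := by rw [← inner_conj_symm, Complex.conj_im]
    have j3 : (⟪η, z x⟫_ℂ).re = 0 := by rw [← inner_conj_symm, Complex.conj_re, hre2]
    rw [hre1, hre2] at i1
    simp only [conjVecL_apply, inner_conjVec, j1, j2, j3, hre] at i2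
    have e1' : ⟪(stenzelMap (z x, ν)).1,
        (Complex.I • stenzelVelocity (z x) ν (fderiv ℝ z x u) η).1⟫_ℝ = _ := e1.trans
          (congrArg Neg.neg i1)
    have e2' : ⟪(stenzelMap (z x, ν)).2,
        (Complex.I • stenzelVelocity (z x) ν (fderiv ℝ z x u) η).2⟫_ℝ = _ := e2.trans
          (congrArg Neg.neg i2)
    rw [e1', e2']
    ring
  · rw [fderiv_bdot] at hb
    have := congrArg (fun c => Complex.I * c) hb
    simp only [Finset.mul_sum, mul_zero] at this
    rw [← this]
    refine Finset.sum_congr rfl fun j _ => ?_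
    simp
    ring

/-- The normal bundle of any immersion is Lagrangian for the Stenzel form. -/
theorem stenzelForm_eq_zero (h : IsUnitLift z x) (hinj : Function.Injective (hderiv z x))
    (hν : IsNormal z x ν) {w w' : Pair n} (hw : IsTangentAt z x ν w)
    (hw' : IsTangentAt z x ν w') : stenzelForm (PhiHat (z x) ν) w w' = 0 := by
  obtain ⟨P, hP, hev⟩ := exists_normalProj h hinj
  have hPx := hev.self_of_nhds
  set Ψ : Coord k × Hom n → Pair n := fun p => stenzelMap (z p.1, P p.1 p.2) with hΨ
  have hΨν : Ψ (x, ν) = PhiHat (z x) ν := by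
    simp only [hΨ, hPx.2 ν hν, PhiHat_eq_stenzelMap h.norm_self]
  have hsmooth : ∀ {y : Coord k} {v : Hom n}, IsUnitLift z y → ContDiffAt ℝ 2 P y →
      ContDiffAt ℝ 2 Ψ (y, v) := by
    intro y v hy hPy
    have h1 : ContDiffAt ℝ 2 (fun p : Coord k × Hom n => z p.1) (y, v) :=
      ContDiffAt.comp (y, v) (hy.contDiffAt.of_le (WithTop.coe_le_coe.2 (le_top : (2 : ℕ∞) ≤ ⊤)))
        contDiffAt_fst
    have h2 : ContDiffAt ℝ 2 (fun p : Coord k × Hom n => P p.1 p.2) (y, v) :=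
      ContDiffAt.clm_apply (ContDiffAt.comp (y, v) hPy contDiffAt_fst) contDiffAt_snd
    exact ContDiffAt.comp (y, v) ((contDiff_stenzelMap.of_le
      (WithTop.coe_le_coe.2 (le_top : (2 : ℕ∞) ≤ ⊤))).contDiffAt) (h1.prodMk h2)
  have hP2 : ContDiffAt ℝ 2 P x := hP.of_le (WithTop.coe_le_coe.2 (le_top : (2 : ℕ∞) ≤ ⊤))
  -- `Ψ` takes values in the image of the normal bundle and is the identity on normal vectors, so
  -- its differential reaches every tangent vector.
  have hvel : ∀ {w : Pair n}, IsTangentAt z x ν w → ∃ p, w = fderiv ℝ Ψ (x, ν) p := by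
    rintro w ⟨γ, ξ, hγ, hξ, hγ0, hξ0, hN, hd⟩
    have hγ' := (hγ.differentiableAt (by simp)).hasDerivAt
    have hξ' := (hξ.differentiableAt (by simp)).hasDerivAt
    have hc : Filter.Tendsto γ (𝓝 0) (𝓝 x) := hγ0 ▸ hγ.continuousAt.tendsto
    have h1 : HasDerivAt (fun s => Ψ (γ s, ξ s)) (fderiv ℝ Ψ (x, ν) (deriv γ 0, deriv ξ 0)) 0 := by
      have hd : HasFDerivAt Ψ (fderiv ℝ Ψ (x, ν)) (γ 0, ξ 0) := by
        rw [hγ0, hξ0]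
        exact ((hsmooth h hP2).differentiableAt (by norm_num)).hasFDerivAt
      exact hd.comp_hasDerivAt (f := fun s => (γ s, ξ s)) (0 : ℝ) (hγ'.prodMk hξ')
    refine ⟨_, HasDerivAt.unique ?_ h1⟩
    refine hd.congr_of_eventuallyEq ?_
    filter_upwards [hc.eventually h.norm_eq, hc.eventually hev, hN] with s h1 h2 h3
    change stenzelMap (z (γ s), P (γ s) (ξ s)) = _
    rw [PhiHat_eq_stenzelMap h1, h2.2 _ h3]
  obtain ⟨p, rfl⟩ := hvel hw
  obtain ⟨p', rfl⟩ := hvel hw'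
  have hfst : Filter.Tendsto (fun q : Coord k × Hom n => q.1) (𝓝 (x, ν)) (𝓝 x) :=
    continuous_fst.tendsto (x, ν)
  have hcontact : ∀ᶠ q in 𝓝 (x, ν), ∀ p,
      fderiv ℝ potential (Ψ q) (Complex.I • fderiv ℝ Ψ q p) = 0 := by
    filter_upwards [hfst.eventually h.eventually, hfst.eventually hev.eventually_nhds,
      hfst.eventually (hP2.eventually (by simp))] with q h1 h2 h3 p
    obtain ⟨y, v⟩ := q
    obtain ⟨u, b⟩ := p
    have hPy := h2.self_of_nhds
    have hγ' : HasDerivAt (fun s : ℝ => y + s • u) u 0 := hasDerivAt_add_smul y u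
    have hPd : DifferentiableAt ℝ (fun p : Coord k × Hom n => P p.1 p.2) (y, v) :=
      (ContDiffAt.clm_apply (ContDiffAt.comp (y, v) h3 contDiffAt_fst)
        contDiffAt_snd).differentiableAt (n := 2) (by norm_num)
    have hξ' : HasDerivAt (fun s : ℝ => P (y + s • u) (v + s • b))
        (fderiv ℝ (fun p : Coord k × Hom n => P p.1 p.2) (y, v) (u, b)) 0 :=
      hPd.hasFDerivAt.hasLineDerivAt (u, b)
    have hc : Filter.Tendsto (fun s : ℝ => y + s • u) (𝓝 0) (𝓝 y) := by
      simpa using hγ'.continuousAt.tendsto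
    have hvel := isNormalVelocity_of_curve (ν := P y v) h1 hγ' hξ' (by simp) (by simp)
      ((hc.eventually h2).mono fun s hs => hs.1 _)
    have hz : HasDerivAt (fun s : ℝ => z (y + s • u)) (fderiv ℝ z y u) 0 :=
      h1.differentiableAt.hasFDerivAt.hasLineDerivAt u
    have hd1 := hasDerivAt_stenzelMap hz hξ'
    have hd2 : HasDerivAt (fun s : ℝ => stenzelMap (z (y + s • u), P (y + s • u) (v + s • b)))
        (fderiv ℝ Ψ (y, v) (u, b)) 0 :=
      ((hsmooth h1 h3).differentiableAt (by norm_num)).hasFDerivAt.hasLineDerivAt (u, b)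
    have hd3 := hd2.unique hd1
    simp only [zero_smul, add_zero] at hd3
    rw [hd3]
    refine fderiv_potential_stenzelVelocity h1 (hPy.1 v) hvel ?_
    have hbd : HasDerivAt (fun s : ℝ => bdot (stenzelMap (z (y + s • u),
        P (y + s • u) (v + s • b)))) (fderiv ℝ bdot (stenzelMap (z y, P y v))
          (fderiv ℝ Ψ (y, v) (u, b))) 0 := by
      have hd : HasFDerivAt bdot (fderiv ℝ bdot (stenzelMap (z y, P y v)))
          (stenzelMap (z (y + (0 : ℝ) • u), P (y + (0 : ℝ) • u) (v + (0 : ℝ) • b))) := by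
        simp only [zero_smul, add_zero]
        exact (contDiff_bdot.contDiffAt.differentiableAt (by norm_num)).hasFDerivAt
      exact hd.comp_hasDerivAt
        (f := fun s : ℝ => stenzelMap (z (y + s • u), P (y + s • u) (v + s • b))) (0 : ℝ) hd2
    rw [← hd3]
    refine hbd.unique ((hasDerivAt_const (0 : ℝ) (1 : ℂ)).congr_of_eventuallyEq ?_)
    filter_upwards [hc.eventually h2, hc.eventually h1.norm_eq] with s hs hs'
    exact bdot_stenzelMap hs' (hs.1 _).1
  have hpot : ContDiffAt ℝ 2 potential (Ψ (x, ν)) := by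
    have hb := bdot_stenzelMap h.norm_self hν.1
    rw [hΨν, PhiHat_eq_stenzelMap h.norm_self]
    have hne : ∀ q : Pair n, bdot q = 1 → q.1 ≠ 0 ∧ q.2 ≠ 0 := by
      intro q hq
      constructor <;> intro h0 <;> simp [bdot, h0] at hq
    exact contDiffAt_potential (hne _ hb).1 (hne _ hb).2 (by rw [hb]; exact one_ne_zero)
  have key := ddc_eq_zero_of_eventually_dc_eq_zero hpot (hsmooth h hP2) hcontact p p'
  rw [stenzelForm, ← hΨν, key, zero_div]

end NormalProj

end

section

variable {n k r : ℕ}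

/-! ### Adapted orthonormal frames -/

/-- `f` is a real orthonormal basis of the horizontal space at `z x`, whose first part is the
orthonormal tangent frame with coordinates `e` and whose second part consists of normal vectors. -/
structure IsAdaptedFrame (z : Coord k → Hom n) (x : Coord k) (e : Fin k → Coord k)
    (f : Fin k ⊕ Fin r → Hom n) : Prop where
  orthonormal : Orthonormal ℝ f
  inl_eq : ∀ a, f (Sum.inl a) = hderiv z x (e a)
  isNormal : ∀ d, IsNormal z x (f (Sum.inr d))
  horizontal : ∀ i, ⟪z x, f i⟫_ℂ = 0
  sum_eq : ∀ y, ⟪z x, y⟫_ℂ = 0 → ∑ i, ⟪f i, y⟫_ℝ • f i = y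

section Frame

variable {z : Coord k → Hom n} {x : Coord k} {e : Fin k → Coord k}

lemma eq_sum_of_orthonormal_hderiv (he : Orthonormal ℝ fun a => hderiv z x (e a)) (u : Coord k) :
    u = ∑ a, ⟪hderiv z x (e a), hderiv z x u⟫_ℝ • e a := by
  have hli : LinearIndependent ℝ e :=
    LinearIndependent.of_comp (hderiv z x).toLinearMap he.linearIndependent
  have hspan := hli.span_eq_top_of_card_eq_finrank' (by simp)
  obtain ⟨c, hc⟩ := (Submodule.mem_span_range_iff_exists_fun ℝ).1
    (hspan ▸ Submodule.mem_top : u ∈ Submodule.span ℝ (Set.range e))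
  rw [← hc]
  refine Finset.sum_congr rfl fun a _ => ?_
  rw [map_sum]
  simp only [map_smul]
  rw [he.inner_right_fintype]

lemma injective_hderiv_of_orthonormal (he : Orthonormal ℝ fun a => hderiv z x (e a)) :
    Function.Injective (hderiv z x) := by
  rw [injective_iff_map_eq_zero]
  intro u hu
  rw [eq_sum_of_orthonormal_hderiv he u, hu]
  simp

lemma exists_isAdaptedFrame (h : ‖z x‖ = 1) (he : Orthonormal ℝ fun a => hderiv z x (e a)) :
    k ≤ 2 * n ∧ ∃ f : Fin k ⊕ Fin (2 * n - k) → Hom n, IsAdaptedFrame z x e f := by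
  set g : Bool ⊕ Fin k → Hom n :=
    Sum.elim (fun b => cond b (J (z x)) (z x)) fun a => hderiv z x (e a) with hg
  have hz : ∀ u, ⟪z x, hderiv z x u⟫_ℂ = 0 := IsUnitLift.inner_hderiv h
  have hz' : ∀ u, ⟪hderiv z x u, z x⟫_ℂ = 0 := fun u => inner_eq_zero_symm.1 (hz u)
  have hgo : Orthonormal ℝ g := by
    rw [orthonormal_iff_ite]
    rintro ((_ | _) | a) ((_ | _) | b)
    · simp [hg, h]
    · simp [hg, inner_J_right, h]
    · simp [hg, real_inner_eq_re, hz]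
    · simp [hg, inner_J_left, h]
    · simp [hg, J, norm_smul, h]
    · simp [hg, inner_J_left, hz]
    · simp [hg, real_inner_eq_re, hz']
    · simp [hg, inner_J_right, hz']
    · simpa [hg] using orthonormal_iff_ite.1 he a b
  set K := Submodule.span ℝ (Set.range g) with hK
  have hfK : Module.finrank ℝ K = k + 2 := by
    rw [hK, finrank_span_eq_card hgo.linearIndependent]
    simp [add_comm]
  have hfin : Module.finrank ℝ (Hom n) = 2 * (n + 1) := by
    rw [finrank_real_of_complex]; simp
  have hsum := K.finrank_add_finrank_orthogonal
  have hle : k ≤ 2 * n := by omega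
  have hr : Module.finrank ℝ Kᗮ = 2 * n - k := by omega
  refine ⟨hle, ?_⟩
  set η : OrthonormalBasis (Fin (2 * n - k)) ℝ Kᗮ :=
    (stdOrthonormalBasis ℝ Kᗮ).reindex (finCongr hr) with hη
  have hKorth : ∀ v : Kᗮ, ∀ i, ⟪g i, (v : Hom n)⟫_ℝ = 0 := fun v i =>
    Submodule.inner_right_of_mem_orthogonal
      (Submodule.subset_span (Set.mem_range_self i) : g i ∈ K) v.2
  have hmemK : ∀ y, (∀ i, ⟪g i, y⟫_ℝ = 0) → y ∈ Kᗮ := by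
    intro y hy
    rw [Submodule.mem_orthogonal]
    intro u hu
    induction hu using Submodule.span_induction with
    | mem u hu => obtain ⟨i, rfl⟩ := hu; exact hy i
    | zero => simp
    | add u w _ _ hu hw => rw [inner_add_left, hu, hw, add_zero]
    | smul c u _ hu => rw [inner_smul_left, hu, mul_zero]
  have hηz : ∀ v : Kᗮ, ⟪z x, (v : Hom n)⟫_ℂ = 0 := by
    intro v
    apply Complex.ext
    · simpa [hg, real_inner_eq_re] using hKorth v (Sum.inl false)
    · simpa [hg, inner_J_left] using hKorth v (Sum.inl true)
  have hηX : ∀ (v : Kᗮ) u, ⟪hderiv z x u, (v : Hom n)⟫_ℝ = 0 := by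
    intro v u
    rw [eq_sum_of_orthonormal_hderiv he u, map_sum, sum_inner]
    refine Finset.sum_eq_zero fun a _ => ?_
    rw [map_smul, real_inner_smul_left]
    exact mul_eq_zero_of_right _ (hKorth v (Sum.inr a))
  refine ⟨Sum.elim (fun a => hderiv z x (e a)) fun d => (η d : Hom n), ?_, fun a => rfl,
    fun d => isNormal_iff.2 ⟨hηz _, hηX _⟩, ?_, ?_⟩
  · rw [orthonormal_iff_ite]
    rintro (a | a) (b | b)
    · simpa using orthonormal_iff_ite.1 he a b
    · simpa using hηX _ _
    · rw [real_inner_comm]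
      simpa using hηX _ _
    · simpa using orthonormal_iff_ite.1 η.orthonormal a b
  · rintro (a | d)
    · exact hz _
    · exact hηz _
  · intro y hy
    rw [Fintype.sum_sum_type]
    simp only [Sum.elim_inl, Sum.elim_inr]
    set y' := y - ∑ a, ⟪hderiv z x (e a), y⟫_ℝ • hderiv z x (e a) with hy'
    have hzy' : ⟪z x, y'⟫_ℂ = 0 := by
      rw [hy', inner_sub_right, hy, inner_sum, Finset.sum_eq_zero, sub_zero]
      intro a _
      rw [show ⟪hderiv z x (e a), y⟫_ℝ • hderiv z x (e a)
        = (⟪hderiv z x (e a), y⟫_ℝ : ℂ) • hderiv z x (e a) from rfl, inner_smul_right, hz, mul_zero]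
    have hmem : y' ∈ Kᗮ := by
      refine hmemK _ ?_
      rintro ((_ | _) | a)
      · simp [hg, real_inner_eq_re, hzy']
      · simp [hg, inner_J_left, hzy']
      · simp only [hg, Sum.elim_inr, hy', inner_sub_right]
        rw [he.inner_right_fintype, sub_self]
    have h1 := congrArg (fun v : Kᗮ => (v : Hom n)) (η.sum_repr' ⟨y', hmem⟩)
    simp only [Submodule.coe_sum, Submodule.coe_smul, Submodule.coe_inner] at h1
    have h2 : ∀ d, ⟪(η d : Hom n), y⟫_ℝ = ⟪(η d : Hom n), y'⟫_ℝ := by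
      intro d
      rw [hy', inner_sub_right, inner_sum, Finset.sum_eq_zero, sub_zero]
      intro a _
      have h3 := hηX (η d) (e a)
      rw [real_inner_comm] at h3
      rw [real_inner_smul_right, h3, mul_zero]
    simp only [h2]
    rw [h1, hy']
    abel

end Frame

/-! ### The volume form on the tangent spaces of the normal bundle -/

/-- Expansion of a tangent vector modulo the radial directions, with `c = C⁻¹`. The radial vectors
absorb the part of the velocity along `ζ`, which produces the term in `J ν`. -/
lemma stenzel_expansion (ζ ν X y : Hom n) {C S C' S' θ g c : ℝ} (hC : C * c = 1) :
    ((C • (X + (Complex.I * θ) • ζ) + C' • ζ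
        + (S • J (y + θ • J ν + (Complex.I * g) • ζ) + S' • J ν),
      C • conjVecL (X + (Complex.I * θ) • ζ) + C' • conjVecL ζ
        + (S • J (conjVecL (y + θ • J ν + (Complex.I * g) • ζ)) + S' • J (conjVecL ν))) : Pair n)
      = (Complex.I * θ + (C' - S * g) * c) • ((C • ζ + S • J ν, 0) : Pair n)
        + (-(Complex.I * θ) + (C' + S * g) * c)
          • ((0, C • conjVecL ζ + S • J (conjVecL ν)) : Pair n)
        + ((C : ℂ) • realPair X + (Complex.I * S) • realPair y
          + (Complex.I * (S' - S * C' * c)) • realPair ν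
          + ((S ^ 2 * g * c : ℝ) : ℂ) • realPair (J ν)) := by
  have hC' : (C : ℂ) * c = 1 := by exact_mod_cast hC
  apply Prod.ext
  · ext i
    simp [J, realPair]
    linear_combination (S * g * ζ i) * Complex.I_sq - ((C' - S * g) * ζ i) * hC'
  · ext i
    simp [J, realPair]
    linear_combination (-(S * g * (starRingEnd ℂ) (ζ i))) * Complex.I_sq
      - ((C' + S * g) * (starRingEnd ℂ) (ζ i)) * hC'

/-- The tangential block of the volume form: `C + C⁻¹ S² p pᵀ - i S (ν · II)`, where
`C = cosh |ν|`, `S = sinh |ν| / |ν|` and `p` is the tangential part of `J ν`. -/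
def shapeMatrix (z : Coord k → Hom n) (x : Coord k) (ν : Hom n) (e : Fin k → Coord k) :
    Matrix (Fin k) (Fin k) ℂ :=
  Matrix.of fun a b => (if a = b then (coshSqrt (‖ν‖ ^ 2) : ℂ) else 0)
    - Complex.I * sinhcSqrt (‖ν‖ ^ 2) * secondFF z x ν (e a) (e b)
    + ((sinhcSqrt (‖ν‖ ^ 2) ^ 2 * (coshSqrt (‖ν‖ ^ 2))⁻¹ * ⟪hderiv z x (e a), J ν⟫_ℝ
      * ⟪hderiv z x (e b), J ν⟫_ℝ : ℝ) : ℂ)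

/-- The normal block of the volume form, up to a factor `i`: the derivative of
`ξ ↦ (sinh |ξ| / |ξ|) ξ` at `ν` in normal directions, corrected by the radial direction. -/
def fibreMatrix (ν : Hom n) (f : Fin k ⊕ Fin r → Hom n) : Matrix (Fin r) (Fin r) ℝ :=
  Matrix.of fun c d => (if c = d then sinhcSqrt (‖ν‖ ^ 2) else 0)
    + 2 * (deriv sinhcSqrt (‖ν‖ ^ 2)
        - sinhcSqrt (‖ν‖ ^ 2) * deriv coshSqrt (‖ν‖ ^ 2) * (coshSqrt (‖ν‖ ^ 2))⁻¹)
      * (⟪f (Sum.inr c), ν⟫_ℝ * ⟪f (Sum.inr d), ν⟫_ℝ)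

/-- The coordinates in the frame `f` of the velocity of the base point and of the covariant
derivative of the normal vector. -/
def velocityCoords (z : Coord k → Hom n) (x : Coord k) (ν : Hom n) (f : Fin k ⊕ Fin r → Hom n)
    (u : Coord k) (η : Hom n) : Fin k ⊕ Fin r → ℝ :=
  Sum.elim (fun a => ⟪f (Sum.inl a), hderiv z x u⟫_ℝ)
    fun d => ⟪f (Sum.inr d), η⟫_ℝ - (⟪z x, fderiv ℝ z x u⟫_ℂ).im * ⟪f (Sum.inr d), J ν⟫_ℝ

/-- The coefficients in the frame of the tangent vectors of the image of the normal bundle. -/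
def tangentMatrix (z : Coord k → Hom n) (x : Coord k) (ν : Hom n) (e : Fin k → Coord k)
    (f : Fin k ⊕ Fin r → Hom n) : Matrix (Fin k ⊕ Fin r) (Fin k ⊕ Fin r) ℂ :=
  Matrix.fromBlocks (shapeMatrix z x ν e)
    (Matrix.of fun a d => ((sinhcSqrt (‖ν‖ ^ 2) ^ 2 * (coshSqrt (‖ν‖ ^ 2))⁻¹
      * ⟪hderiv z x (e a), J ν⟫_ℝ * ⟪f (Sum.inr d), J ν⟫_ℝ : ℝ) : ℂ))
    0 (Complex.I • (fibreMatrix ν f).map Complex.ofRealHom)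

section Volume

variable {z : Coord k → Hom n} {x : Coord k} {ν : Hom n} {e : Fin k → Coord k}
  {f : Fin k ⊕ Fin r → Hom n}

/-- The tangent vectors of the image of the normal bundle in the complexified frame, modulo the radial
directions. -/
lemma exists_stenzelVelocity_eq (h : IsUnitLift z x) (hν : IsNormal z x ν)
    (hf : IsAdaptedFrame z x e f) {u : Coord k} {η : Hom n} (hη : IsNormalVelocity z x ν u η) :
    ∃ a b : ℂ, stenzelVelocity (z x) ν (fderiv ℝ z x u) η
      = a • (((stenzelMap (z x, ν)).1, 0) : Pair n) + b • ((0, (stenzelMap (z x, ν)).2) : Pair n)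
        + ∑ i, (∑ j, (velocityCoords z x ν f u η j : ℂ) * tangentMatrix z x ν e f j i)
          • realPair (f i) := by
  set θ : ℝ := (⟪z x, fderiv ℝ z x u⟫_ℂ).im with hθ
  set g : ℝ := ⟪hderiv z x u, J ν⟫_ℝ with hg
  set C : ℝ := coshSqrt (‖ν‖ ^ 2) with hCdef
  set S : ℝ := sinhcSqrt (‖ν‖ ^ 2) with hSdef
  have hC : C * C⁻¹ = 1 := mul_inv_cancel₀ (coshSqrt_sq_pos _).ne'
  have hz1 := h.norm_self
  have hzz : ⟪z x, z x⟫_ℂ = 1 := by rw [inner_self_eq_norm_sq_to_K, hz1]; simp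
  have hDz : fderiv ℝ z x u = hderiv z x u + (Complex.I * θ) • z x := by
    have h1 : ⟪z x, fderiv ℝ z x u⟫_ℂ = Complex.I * θ := by
      apply Complex.ext <;> simp [h.re_inner_fderiv, hθ]
    rw [IsUnitLift.hderiv_apply hz1, h1, sub_add_cancel]
  obtain ⟨y, hy⟩ : ∃ y, η = y + θ • J ν + (Complex.I * g) • z x :=
    ⟨η - θ • J ν - (Complex.I * g) • z x, by abel⟩
  have hνz : ⟪ν, z x⟫_ℂ = 0 := inner_eq_zero_symm.1 hν.1
  have hJz : ⟪z x, J ν⟫_ℂ = 0 := by rw [J, inner_smul_right, hν.1, mul_zero]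
  have hθJ : ∀ v : Hom n, θ • v = (θ : ℂ) • v := fun v => rfl
  have hyz : ⟪z x, y⟫_ℂ = 0 := by
    have h1 := hη.inner_self
    rw [hDz, inner_add_left, inner_smul_left, hν.1, mul_zero, add_zero, hν.inner_hderiv_eq, ← hg,
      hy, inner_add_right, inner_add_right, hθJ, inner_smul_right, inner_smul_right, hzz, hJz] at h1
    linear_combination h1
  -- Pairings with horizontal vectors do not see the component of `η` along `z x`.
  have hpair : ∀ v, ⟪z x, v⟫_ℂ = 0 → ⟪v, η⟫_ℝ = ⟪v, y⟫_ℝ + θ * ⟪v, J ν⟫_ℝ := by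
    intro v hv
    have hv' : ⟪v, z x⟫_ℂ = 0 := inner_eq_zero_symm.1 hv
    rw [hy, inner_add_right, inner_add_right, real_inner_smul_right,
      real_inner_eq_re v (_ • z x), inner_smul_right, hv']
    simp
  have hνJ : ⟪ν, J ν⟫_ℝ = 0 := by
    rw [inner_J_right]
    exact neg_eq_zero.2 (inner_self_im (𝕜 := ℂ) ν)
  have hexp : ∀ v, ⟪z x, v⟫_ℂ = 0 → realPair v = ∑ i, (⟪f i, v⟫_ℝ : ℂ) • realPair (f i) := by
    intro v hv
    conv_lhs => rw [← hf.sum_eq v hv]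
    rw [realPair_sum]
    exact Finset.sum_congr rfl fun i _ => realPair_smul _ _
  have hX : ⟪z x, hderiv z x u⟫_ℂ = 0 := IsUnitLift.inner_hderiv hz1 u
  have hXeq : ∀ v, ⟪hderiv z x u, v⟫_ℝ
      = ∑ b, ⟪f (Sum.inl b), hderiv z x u⟫_ℝ * ⟪hderiv z x (e b), v⟫_ℝ := by
    intro v
    have he : Orthonormal ℝ fun a => hderiv z x (e a) := by
      have := hf.orthonormal.comp Sum.inl Sum.inl_injective
      simpa [Function.comp_def, hf.inl_eq] using this
    conv_lhs => rw [eq_sum_of_orthonormal_hderiv he u, map_sum, sum_inner]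
    refine Finset.sum_congr rfl fun b _ => ?_
    rw [map_smul, real_inner_smul_left, hf.inl_eq]
  obtain ⟨B, hB, -⟩ := exists_secondFF_eq h hν
  have hII : ∀ v, secondFF z x ν u v
      = ∑ b, ⟪f (Sum.inl b), hderiv z x u⟫_ℝ * secondFF z x ν (e b) v := by
    intro v
    have he : Orthonormal ℝ fun a => hderiv z x (e a) := by
      have := hf.orthonormal.comp Sum.inl Sum.inl_injective
      simpa [Function.comp_def, hf.inl_eq] using this
    conv_lhs => rw [eq_sum_of_orthonormal_hderiv he u]
    simp only [← hB, map_sum, LinearMap.sum_apply, map_smul, LinearMap.smul_apply, smul_eq_mul,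
      hf.inl_eq]
  have hyl : ∀ c, ⟪f (Sum.inl c), y⟫_ℝ = -secondFF z x ν u (e c) := by
    intro c
    have h1 := hpair _ (hf.horizontal (Sum.inl c))
    rw [hf.inl_eq, hη.inner_hderiv, ← hθ] at h1
    rw [hf.inl_eq]
    linarith
  have hyr : ∀ d, ⟪f (Sum.inr d), y⟫_ℝ = velocityCoords z x ν f u η (Sum.inr d) := by
    intro d
    have h1 := hpair _ (hf.horizontal (Sum.inr d))
    simp only [velocityCoords, Sum.elim_inr]
    linarith
  have hνl : ∀ c, ⟪f (Sum.inl c), ν⟫_ℝ = 0 := fun c => by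
    rw [hf.inl_eq]; exact hν.inner_hderiv _
  have hνη : ⟪ν, η⟫_ℝ = ∑ d, velocityCoords z x ν f u η (Sum.inr d) * ⟪f (Sum.inr d), ν⟫_ℝ := by
    rw [hpair ν hν.1, hνJ, mul_zero, add_zero]
    conv_lhs => rw [← hf.sum_eq ν hν.1, sum_inner, Fintype.sum_sum_type]
    simp only [hνl, zero_smul, inner_zero_left, Finset.sum_const_zero, zero_add,
      real_inner_smul_left, hyr]
    exact Finset.sum_congr rfl fun d _ => mul_comm _ _
  have key := stenzel_expansion (z x) ν (hderiv z x u) y (θ := θ) (g := g) (S := S)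
    (C' := deriv coshSqrt (‖ν‖ ^ 2) * (2 * ⟪ν, η⟫_ℝ))
    (S' := deriv sinhcSqrt (‖ν‖ ^ 2) * (2 * ⟪ν, η⟫_ℝ)) hC
  rw [← hy, ← hDz] at key
  refine ⟨_, _, key.trans (congrArg₂ (· + ·) rfl ?_)⟩
  rw [hexp _ hX, hexp y hyz, hexp ν hν.1, hexp _ hJz, Finset.smul_sum, Finset.smul_sum,
    Finset.smul_sum, Finset.smul_sum, ← Finset.sum_add_distrib, ← Finset.sum_add_distrib,
    ← Finset.sum_add_distrib]
  refine Finset.sum_congr rfl fun i _ => ?_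
  rw [smul_smul, smul_smul, smul_smul, smul_smul, ← add_smul, ← add_smul, ← add_smul]
  congr 1
  rw [Fintype.sum_sum_type]
  rcases i with c | d
  · have e1 : ∑ b, ((⟪f (Sum.inl b), hderiv z x u⟫_ℝ : ℝ) : ℂ)
        * (if b = c then (C : ℂ) else 0) = C * ⟪f (Sum.inl c), hderiv z x u⟫_ℝ := by
      simp [mul_comm]
    rw [hνl, hyl, hII, hg, hXeq (J ν)]
    simp only [velocityCoords, Sum.elim_inl, tangentMatrix, Matrix.fromBlocks_apply₁₁,
      Matrix.fromBlocks_apply₂₁, Matrix.zero_apply, mul_zero, Finset.sum_const_zero, add_zero,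
      shapeMatrix, Matrix.of_apply, ← hCdef, ← hSdef, mul_add, mul_sub, Finset.sum_add_distrib,
      Finset.sum_sub_distrib]
    rw [e1]
    push_cast
    simp only [Finset.mul_sum, Finset.sum_mul, mul_neg, mul_zero, add_zero,
      ← Finset.sum_neg_distrib, sub_eq_add_neg]
    rw [add_assoc, add_assoc, ← Finset.sum_add_distrib, ← Finset.sum_add_distrib]
    congr 1
    refine Finset.sum_congr rfl fun b _ => ?_
    simp only [hf.inl_eq]
    ring
  · have e0 : ⟪f (Sum.inr d), hderiv z x u⟫_ℝ = 0 := by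
      rw [real_inner_comm]; exact (hf.isNormal d).inner_hderiv u
    have e1 : ∑ b, (velocityCoords z x ν f u η (Sum.inr b) : ℂ)
        * (if b = d then (S : ℂ) else 0) = S * velocityCoords z x ν f u η (Sum.inr d) := by
      simp [mul_comm]
    have e2 : ∀ b, (tangentMatrix z x ν e f (Sum.inr b) (Sum.inr d)) = Complex.I *
        ((if b = d then (S : ℂ) else 0) + 2 * (deriv sinhcSqrt (‖ν‖ ^ 2)
          - S * deriv coshSqrt (‖ν‖ ^ 2) * C⁻¹) * (⟪f (Sum.inr b), ν⟫_ℝ * ⟪f (Sum.inr d), ν⟫_ℝ)) := by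
      intro b
      simp only [tangentMatrix, fibreMatrix, Matrix.fromBlocks_apply₂₂, Matrix.smul_apply,
        Matrix.map_apply, Matrix.of_apply, smul_eq_mul, ← hCdef, ← hSdef]
      split_ifs <;> simp
    rw [e0, hyr, hνη, hg, hXeq (J ν)]
    have e3 : ∑ b, (velocityCoords z x ν f u η (Sum.inr b) : ℂ)
        * tangentMatrix z x ν e f (Sum.inr b) (Sum.inr d)
        = Complex.I * S * velocityCoords z x ν f u η (Sum.inr d) + Complex.I * ∑ b,
          (velocityCoords z x ν f u η (Sum.inr b) : ℂ) * (2 * (deriv sinhcSqrt (‖ν‖ ^ 2)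
          - S * deriv coshSqrt (‖ν‖ ^ 2) * C⁻¹) * (⟪f (Sum.inr b), ν⟫_ℝ * ⟪f (Sum.inr d), ν⟫_ℝ)) := by
      rw [mul_assoc, ← e1, ← mul_add, ← Finset.sum_add_distrib, Finset.mul_sum]
      refine Finset.sum_congr rfl fun b _ => ?_
      rw [e2]
      ring
    rw [e3]
    simp only [tangentMatrix, Matrix.fromBlocks_apply₁₂, Matrix.of_apply, ← hCdef, ← hSdef]
    have e4 : ∑ b, (velocityCoords z x ν f u η (Sum.inr b) : ℂ) * (2 * (deriv sinhcSqrt (‖ν‖ ^ 2)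
          - S * deriv coshSqrt (‖ν‖ ^ 2) * C⁻¹) * (⟪f (Sum.inr b), ν⟫_ℝ * ⟪f (Sum.inr d), ν⟫_ℝ))
        = (∑ b, (velocityCoords z x ν f u η (Sum.inr b) : ℂ) * ⟪f (Sum.inr b), ν⟫_ℝ)
          * (2 * (deriv sinhcSqrt (‖ν‖ ^ 2)
          - S * deriv coshSqrt (‖ν‖ ^ 2) * C⁻¹) * ⟪f (Sum.inr d), ν⟫_ℝ) := by
      rw [Finset.sum_mul]
      exact Finset.sum_congr rfl fun b _ => by ring
    have e5 : ∑ a, (velocityCoords z x ν f u η (Sum.inl a) : ℂ) * ((S ^ 2 * C⁻¹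
          * ⟪hderiv z x (e a), J ν⟫_ℝ * ⟪f (Sum.inr d), J ν⟫_ℝ : ℝ) : ℂ)
        = (∑ a, (⟪f (Sum.inl a), hderiv z x u⟫_ℝ : ℂ) * ⟪hderiv z x (e a), J ν⟫_ℝ)
          * (S ^ 2 * C⁻¹ * ⟪f (Sum.inr d), J ν⟫_ℝ) := by
      rw [Finset.sum_mul]
      refine Finset.sum_congr rfl fun b _ => ?_
      simp only [velocityCoords, Sum.elim_inl]
      push_cast
      ring
    rw [e4, e5]
    push_cast
    ring

lemma PhiHat_pair (h : ‖z x‖ = 1) :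
    PhiHat (z x) ν = ((stenzelMap (z x, ν)).1, (stenzelMap (z x, ν)).2) :=
  PhiHat_eq_stenzelMap h ν

/-- The radial vectors in terms of the frame. -/
lemma exists_stenzelMap_eq (hν : IsNormal z x ν) (hf : IsAdaptedFrame z x e f) :
    ∃ α β : Fin k ⊕ Fin r → ℂ,
      (((stenzelMap (z x, ν)).1, 0) : Pair n) = (coshSqrt (‖ν‖ ^ 2) : ℂ) • ((z x, 0) : Pair n)
        + ∑ i, α i • realPair (f i) ∧
      ((0, (stenzelMap (z x, ν)).2) : Pair n)
        = (coshSqrt (‖ν‖ ^ 2) : ℂ) • ((0, conjVec (z x)) : Pair n)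
        + ∑ i, β i • realPair (f i) := by
  have hexp : ∀ v, ⟪z x, v⟫_ℂ = 0 → realPair v = ∑ i, (⟪f i, v⟫_ℝ : ℂ) • realPair (f i) := by
    intro v hv
    conv_lhs => rw [← hf.sum_eq v hv]
    rw [realPair_sum]
    exact Finset.sum_congr rfl fun i _ => realPair_smul _ _
  have hJz : ⟪z x, J ν⟫_ℂ = 0 := by rw [J, inner_smul_right, hν.1, mul_zero]
  set S : ℝ := sinhcSqrt (‖ν‖ ^ 2) with hS
  refine ⟨fun i => S / 2 * (⟪f i, J ν⟫_ℝ + Complex.I * ⟪f i, ν⟫_ℝ),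
    fun i => S / 2 * (-⟪f i, J ν⟫_ℝ + Complex.I * ⟪f i, ν⟫_ℝ), ?_, ?_⟩
  · have h1 : ∑ i, (S / 2 * (⟪f i, J ν⟫_ℝ + Complex.I * ⟪f i, ν⟫_ℝ) : ℂ) • realPair (f i)
        = (S / 2 : ℂ) • (realPair (J ν) + Complex.I • realPair ν) := by
      rw [hexp _ hJz, hexp _ hν.1, Finset.smul_sum, ← Finset.sum_add_distrib, Finset.smul_sum]
      refine Finset.sum_congr rfl fun i _ => ?_
      rw [smul_smul, ← add_smul, smul_smul]
    rw [h1]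
    apply Prod.ext
    · ext i
      simp [stenzelMap, realPair, J, ← hS]
      ring
    · ext i
      simp [realPair, J]
  · have h1 : ∑ i, (S / 2 * (-⟪f i, J ν⟫_ℝ + Complex.I * ⟪f i, ν⟫_ℝ) : ℂ) • realPair (f i)
        = (S / 2 : ℂ) • (-realPair (J ν) + Complex.I • realPair ν) := by
      rw [hexp _ hJz, hexp _ hν.1, Finset.smul_sum, ← Finset.sum_neg_distrib,
        ← Finset.sum_add_distrib, Finset.smul_sum]
      refine Finset.sum_congr rfl fun i _ => ?_
      rw [smul_smul, ← neg_smul, ← add_smul, smul_smul]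
    rw [h1]
    apply Prod.ext
    · ext i
      simp [realPair, J]
    · ext i
      simp [stenzelMap, realPair, J, ← hS]
      ring

lemma det_fibreMatrix_ne_zero (hν : IsNormal z x ν) (hν0 : ν ≠ 0) (hf : IsAdaptedFrame z x e f) :
    (fibreMatrix ν f).det ≠ 0 := by
  have hμ : ‖ν‖ ≠ 0 := norm_ne_zero_iff.2 hν0
  set S : ℝ := sinhcSqrt (‖ν‖ ^ 2) with hS
  set C : ℝ := coshSqrt (‖ν‖ ^ 2) with hC
  have hCpos : 0 < C := coshSqrt_sq_pos _
  have hSpos : 0 < S := by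
    have h1 := sinhcSqrt_sq_mul ‖ν‖
    have h2 : 0 < Real.sinh ‖ν‖ := Real.sinh_pos_iff.2 (norm_pos_iff.2 hν0)
    rw [← h1] at h2
    exact (pos_iff_pos_of_mul_pos h2).2 (norm_pos_iff.2 hν0)
  set c : ℝ := 2 * (deriv sinhcSqrt (‖ν‖ ^ 2) - S * deriv coshSqrt (‖ν‖ ^ 2) * C⁻¹) with hc
  have hsum : ∑ d, ⟪f (Sum.inr d), ν⟫_ℝ * ⟪f (Sum.inr d), ν⟫_ℝ = ‖ν‖ ^ 2 := by
    rw [← real_inner_self_eq_norm_sq]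
    conv_rhs => rw [← hf.sum_eq ν hν.1, sum_inner, Fintype.sum_sum_type]
    simp only [hf.inl_eq, hν.inner_hderiv, zero_smul, inner_zero_left, Finset.sum_const_zero,
      zero_add, real_inner_smul_left]
    rw [hf.sum_eq ν hν.1]
  have hfac : fibreMatrix ν f = S • (1 + Matrix.replicateCol Unit
      (fun d => S⁻¹ * c * ⟪f (Sum.inr d), ν⟫_ℝ)
      * Matrix.replicateRow Unit fun d => ⟪f (Sum.inr d), ν⟫_ℝ) := by
    ext a b
    simp only [fibreMatrix, Matrix.of_apply, Matrix.smul_apply, Matrix.add_apply,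
      Matrix.one_apply, Matrix.mul_apply, Matrix.replicateCol_apply, Matrix.replicateRow_apply,
      Finset.univ_unique, Finset.sum_singleton, smul_eq_mul, ← hS, ← hC, ← hc]
    field_simp
    split_ifs <;> ring
  rw [hfac, Matrix.det_smul, Matrix.det_one_add_replicateCol_mul_replicateRow]
  refine mul_ne_zero (pow_ne_zero _ hSpos.ne') ?_
  have hdot : (fun d => ⟪f (Sum.inr d), ν⟫_ℝ) ⬝ᵥ (fun d => S⁻¹ * c * ⟪f (Sum.inr d), ν⟫_ℝ)
      = S⁻¹ * c * ‖ν‖ ^ 2 := by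
    rw [← hsum, dotProduct, Finset.mul_sum]
    exact Finset.sum_congr rfl fun d _ => by ring
  rw [hdot]
  have hd1 := deriv_coshSqrt_sq ‖ν‖ hμ
  have hd2 := deriv_sinhcSqrt_sq ‖ν‖
  have hd3 := coshSqrt_sq_sub ‖ν‖
  rw [← hS] at hd1 hd2 hd3
  rw [← hC] at hd2 hd3
  -- The radial stretching factor is `1 / cosh`.
  have h1 : S * (1 + S⁻¹ * c * ‖ν‖ ^ 2) = C⁻¹ := by
    rw [hc]
    field_simp
    linear_combination (C : ℝ) * hd2 - S * ‖ν‖ ^ 2 * hd1 + hd3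
  intro h0
  rw [h0, mul_zero] at h1
  exact (inv_pos.2 hCpos).ne h1

end Volume

/-- The phase of the holomorphic volume form on the tangent spaces of the normal bundle is that of
`det (shapeMatrix z x ν e)`, up to a constant `κ` which depends on the dimensions only. -/
theorem exists_holVol_phase (n k : ℕ) : ∃ κ : ℂ, ‖κ‖ = 1 ∧
    ∀ (z : Coord k → Hom n) (x : Coord k) (ν : Hom n) (e : Fin k → Coord k), IsUnitLift z x →
      (Orthonormal ℝ fun a => hderiv z x (e a)) → IsNormal z x ν →
      (∀ v : Fin n ⊕ Fin n → Pair n, (∀ a, IsTangentAt z x ν (v a)) →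
        ∃ ρ : ℝ, holVol (PhiHat (z x) ν) v = ρ * (κ * (shapeMatrix z x ν e).det)) ∧
      (ν ≠ 0 → ∃ v : Fin n ⊕ Fin n → Pair n, (∀ a, IsTangentAt z x ν (v a)) ∧
        ∃ ρ : ℝ, ρ ≠ 0 ∧
          holVol (PhiHat (z x) ν) v = ρ * (κ * (shapeMatrix z x ν e).det)) := by
  obtain ⟨κ, hκ, hvol⟩ := exists_holVol_eq_det n
  refine ⟨κ * Complex.I ^ (2 * n - k), by simp [hκ], fun z x ν e h he hν => ?_⟩
  obtain ⟨hk, f, hf⟩ := exists_isAdaptedFrame h.norm_self he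
  set τ : Fin n ⊕ Fin n ≃ Fin k ⊕ Fin (2 * n - k) :=
    Fintype.equivOfCardEq (by simp; omega) with hτ
  obtain ⟨σ, hσ, hvol⟩ := hvol (z x) (f ∘ τ) h.norm_self
    (hf.orthonormal.comp τ τ.injective) fun i => hf.horizontal _
  obtain ⟨α, β, hα, hβ⟩ := exists_stenzelMap_eq hν hf
  have hre : ∀ c : Fin k ⊕ Fin (2 * n - k) → ℂ,
      ∑ i, c i • realPair (f i) = ∑ i, c (τ i) • realPair ((f ∘ τ) i) := fun c =>
    (Equiv.sum_comp τ fun i => c i • realPair (f i)).symm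
  rw [hre] at hα hβ
  set C : ℝ := coshSqrt (‖ν‖ ^ 2) with hC
  have hCpos : 0 < C := coshSqrt_sq_pos _
  have hb : bdot ((stenzelMap (z x, ν)).1, (stenzelMap (z x, ν)).2) = 1 :=
    bdot_stenzelMap h.norm_self hν.1
  -- The volume form on arbitrary tangent vectors.
  have hmain : ∀ (u : Fin n ⊕ Fin n → Coord k) (η : Fin n ⊕ Fin n → Hom n),
      (∀ a, IsNormalVelocity z x ν (u a) (η a)) →
      holVol (PhiHat (z x) ν) (fun a => stenzelVelocity (z x) ν (fderiv ℝ z x (u a)) (η a))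
        = (σ * C ^ 2 * (Matrix.of fun a j => velocityCoords z x ν f (u a) (η a) (τ j)).det
          * (fibreMatrix ν f).det : ℝ)
          * (κ * Complex.I ^ (2 * n - k) * (shapeMatrix z x ν e).det) := by
    intro u η hη
    choose a b hab using fun j => exists_stenzelVelocity_eq h hν hf (hη j)
    rw [PhiHat_pair h.norm_self]
    have h1 := hvol _ _ C _ _ a b
      (Matrix.of fun j i => ∑ l, (velocityCoords z x ν f (u j) (η j) l : ℂ)
        * tangentMatrix z x ν e f l (τ i))
      (fun j => stenzelVelocity (z x) ν (fderiv ℝ z x (u j)) (η j)) hα hβ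
      (fun j => (hab j).trans (by rw [hre]; rfl))
    rw [h1, hb, one_pow, div_one]
    have h2 : (Matrix.of fun j i => ∑ l, (velocityCoords z x ν f (u j) (η j) l : ℂ)
        * tangentMatrix z x ν e f l (τ i))
        = (Matrix.of fun a j => velocityCoords z x ν f (u a) (η a) (τ j)).map Complex.ofRealHom
          * (tangentMatrix z x ν e f).submatrix τ τ := by
      ext j i
      rw [Matrix.mul_apply]
      simp only [Matrix.of_apply, Matrix.map_apply, Matrix.submatrix_apply,
        Complex.ofRealHom_eq_coe]
      exact (Equiv.sum_comp τ fun l => (velocityCoords z x ν f (u j) (η j) l : ℂ)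
        * tangentMatrix z x ν e f l (τ i)).symm
    have h3 : ∀ {m : Type} [Fintype m] [DecidableEq m] (A : Matrix m m ℝ),
        (A.map Complex.ofRealHom).det = ((A.det : ℝ) : ℂ) := fun A =>
      (RingHom.map_det Complex.ofRealHom A).symm
    rw [h2, Matrix.det_mul, Matrix.det_submatrix_equiv_self, tangentMatrix,
      Matrix.det_fromBlocks_zero₂₁, Matrix.det_smul, h3, h3, Fintype.card_fin]
    push_cast
    ring
  refine ⟨fun v hv => ?_, fun hν0 => ?_⟩
  · choose u η hη hw using fun a => stenzelVelocity_of_isTangentAt h (hv a)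
    exact ⟨_, by rw [funext hw]; exact hmain u η hη⟩
  · have hinj := injective_hderiv_of_orthonormal he
    choose η₁ hη₁ ht₁ _heq₁ using fun a : Fin k =>
      exists_isTangentAt h hinj hν (e a) (isNormal_iff.2 ⟨inner_zero_right _, fun _ =>
        inner_zero_right _⟩ : IsNormal z x 0)
    choose η₂ hη₂ ht₂ heq₂ using fun d : Fin (2 * n - k) =>
      exists_isTangentAt h hinj hν 0 (hf.isNormal d)
    set u : Fin k ⊕ Fin (2 * n - k) → Coord k := Sum.elim e fun _ => 0 with hu
    set η : Fin k ⊕ Fin (2 * n - k) → Hom n := Sum.elim η₁ η₂ with hη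
    have hηv : ∀ i, IsNormalVelocity z x ν (u i) (η i) := by
      rintro (i | i)
      · exact hη₁ i
      · exact hη₂ i
    have ht : ∀ i, IsTangentAt z x ν
        (stenzelVelocity (z x) ν (fderiv ℝ z x (u i)) (η i)) := by
      rintro (i | i)
      · exact ht₁ i
      · exact ht₂ i
    have hmat : (Matrix.of fun a j => velocityCoords z x ν f (u (τ a)) (η (τ a)) (τ j))
        = (Matrix.fromBlocks 1 (Matrix.of fun a d =>
          velocityCoords z x ν f (e a) (η₁ a) (Sum.inr d)) 0 1).submatrix τ τ := by
      have h1 : (Matrix.of fun i j => velocityCoords z x ν f (u i) (η i) j)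
          = Matrix.fromBlocks 1 (Matrix.of fun a d =>
            velocityCoords z x ν f (e a) (η₁ a) (Sum.inr d)) 0 1 := by
        ext i j
        rcases i with i | i <;> rcases j with j | j
        · have := orthonormal_iff_ite.1 he j i
          simp [velocityCoords, hu, hf.inl_eq, this, Matrix.one_apply, eq_comm]
        · rfl
        · simp [velocityCoords, hu]
        · have h2 := orthonormal_iff_ite.1 hf.orthonormal (Sum.inr j) (Sum.inr i)
          simp [velocityCoords, hu, hη, heq₂, h2, Matrix.one_apply, eq_comm]
      rw [← h1]
      rfl
    refine ⟨fun a => stenzelVelocity (z x) ν (fderiv ℝ z x (u (τ a))) (η (τ a)), fun a => ?_, _, ?_,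
      hmain (fun a => u (τ a)) (fun a => η (τ a)) fun a => hηv _⟩
    · exact ht (τ a)
    · rw [hmat, Matrix.det_submatrix_equiv_self, Matrix.det_fromBlocks_zero₂₁, Matrix.det_one,
        Matrix.det_one]
      have := det_fibreMatrix_ne_zero hν hν0 hf
      simp [hσ, hCpos.ne', this]

end

section

variable {n k m : ℕ}

/-! ### The phase as a polynomial in `tanh` -/

section Coeff

variable {z : Coord k → Hom n} {x : Coord k} {ν : Hom n} {e : Fin k → Coord k}
  {ehat : Fin m → Coord k}

lemma norm_J (ν : Hom n) : ‖J ν‖ = ‖ν‖ := by simp [J, norm_smul]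

/-- The square of the cosine of the angle between a unit vector and a subspace is the square of
the norm of the projection. -/
lemma cos_angleTo_sq {w : Hom n} (hw : ‖w‖ = 1) {T : Submodule ℝ (Hom n)} {f : Fin m → Hom n}
    (hf : Orthonormal ℝ f) (hs : Submodule.span ℝ (Set.range f) = T) :
    Real.cos (angleTo w T) ^ 2 = ∑ a, ⟪f a, w⟫_ℝ ^ 2 := by
  subst hs
  set T := Submodule.span ℝ (Set.range f) with hT
  have hmem : ∀ a, f a ∈ T := fun a => Submodule.subset_span ⟨a, rfl⟩
  have hP : T.starProjection w = ∑ a, ⟪f a, w⟫_ℝ • f a := by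
    refine (Submodule.eq_starProjection_of_mem_of_inner_eq_zero
      (Submodule.sum_mem _ fun a _ => Submodule.smul_mem _ _ (hmem a)) fun v hv => ?_)
    induction hv using Submodule.span_induction with
    | mem v hv =>
      obtain ⟨b, rfl⟩ := hv
      rw [inner_sub_left, sum_inner, sub_eq_zero]
      simp only [real_inner_smul_left, orthonormal_iff_ite.1 hf, mul_ite, mul_one, mul_zero,
        Finset.sum_ite_eq', Finset.mem_univ, if_true]
      exact real_inner_comm _ _
    | zero => simp
    | add u v _ _ hu hv => rw [inner_add_right, hu, hv, add_zero]
    | smul c v _ hv => rw [inner_smul_right, hv, mul_zero]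
  have h1 : ⟪w, T.starProjection w⟫_ℝ = ∑ a, ⟪f a, w⟫_ℝ ^ 2 := by
    rw [hP, inner_sum]
    refine Finset.sum_congr rfl fun a _ => ?_
    rw [inner_smul_right, real_inner_comm, sq]
  have h2 : ‖T.starProjection w‖ ^ 2 = ∑ a, ⟪f a, w⟫_ℝ ^ 2 := by
    rw [← real_inner_self_eq_norm_sq]
    conv_lhs => rw [hP]
    rw [hf.inner_sum]
    simp [sq]
  rw [angleTo, InnerProductGeometry.cos_angle, hw, one_mul, h1, ← h2]
  rcases eq_or_ne ‖T.starProjection w‖ 0 with h0 | h0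
  · rw [h0]; simp
  · field_simp

/-- The coefficient `H^{(d)} - cos²θ Ĥ^{(d-2)}` of the polynomial which gives the phase of the
volume form, with `cos²θ` written as the squared norm of the tangential part of `J ν`. -/
def phaseCoeff (z : Coord k → Hom n) (x : Coord k) (ν : Hom n) (e : Fin k → Coord k)
    (ehat : Fin m → Coord k) (d : ℕ) : ℝ :=
  elemSymm (secondFFMatrix z x ν e) d
    - (∑ a, ⟪hderiv z x (e a), J ν⟫_ℝ ^ 2) * elemSymm (secondFFMatrix z x ν ehat) (d - 2)

lemma phaseCoeff_zero : phaseCoeff z x ν e ehat 0 = 1 := by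
  have h : elemSymm (secondFFMatrix z x ν ehat) (((0 : ℕ) : ℤ) - 2) = 0 := by simp [elemSymm]
  rw [phaseCoeff, h, Nat.cast_zero, elemSymm_zero, mul_zero, sub_zero]

lemma secondFF_smul (t : ℝ) (u v : Coord k) :
    secondFF z x (t • ν) u v = t * secondFF z x ν u v := real_inner_smul_right _ _ _

lemma inner_J_smul (X : Hom n) (t : ℝ) : ⟪X, J (t • ν)⟫_ℝ = t * ⟪X, J ν⟫_ℝ := by
  rw [J, smul_comm, real_inner_smul_right, J]

/-- Along the ray `t ν`, the phase of the volume form is that of a polynomial in `-i tanh t`. -/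
lemma det_shapeMatrix_smul (h : IsUnitLift z x) (hν : IsNormal z x ν) (hν1 : ‖ν‖ = 1)
    (he : IsONBasis z x (tangentSubspace z x) e)
    (he' : IsONBasis z x (tangentSubspace z x ⊓ (ℝ ∙ J ν)ᗮ) ehat) (t : ℝ) :
    (shapeMatrix z x (t • ν) e).det = (Real.cosh t : ℂ) ^ k *
      ∑ d ∈ Finset.range (k + 3), (-(Complex.I * (Real.tanh t : ℝ))) ^ d
        * (phaseCoeff z x ν e ehat d : ℂ) := by
  obtain ⟨B, hB, hsymm⟩ := exists_secondFF_eq h hν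
  have hdet := det_one_sub_smul_sub_rankOne (L := (hderiv z x).toLinearMap) (η := J ν) (e := e)
    (ehat := ehat) (finrank_euclideanSpace_fin (𝕜 := ℝ)) he.1 he.2 he'.1 he'.2 B hsymm
    (Complex.I * (Real.tanh t : ℝ)) (Nat.lt_succ_self k)
  have hC : (Real.cosh t : ℂ) ≠ 0 := Complex.ofReal_ne_zero.2 (Real.cosh_pos t).ne'
  have hS := sinhcSqrt_sq_mul t
  have hmat : shapeMatrix z x (t • ν) e = (Real.cosh t : ℂ) •
      Matrix.of fun a b => (if a = b then (1 : ℂ) else 0)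
        - Complex.I * (Real.tanh t : ℝ) * (B (e a) (e b) : ℂ)
        - (Complex.I * (Real.tanh t : ℝ)) ^ 2 * ((⟪(hderiv z x).toLinearMap (e a), J ν⟫_ℝ
          * ⟪(hderiv z x).toLinearMap (e b), J ν⟫_ℝ : ℝ) : ℂ) := by
    ext a b
    have hn : ‖t • ν‖ ^ 2 = t ^ 2 := by
      rw [norm_smul, hν1, mul_one, Real.norm_eq_abs, sq_abs]
    simp only [shapeMatrix, Matrix.of_apply, Matrix.smul_apply, smul_eq_mul, hn, coshSqrt_sq,
      secondFF_smul, inner_J_smul, hB, ContinuousLinearMap.coe_coe]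
    rw [Real.tanh_eq_sinh_div_cosh, ← hS, mul_pow, Complex.I_sq]
    generalize Real.cosh t = C at hC ⊢
    by_cases hab : a = b
    · simp only [hab, if_true]
      push_cast
      field_simp
      ring
    · simp only [hab, if_false]
      push_cast
      field_simp
      ring
  rw [hmat, Matrix.det_smul, Fintype.card_fin, hdet]
  congr 1
  have hH : ∀ {l : ℕ} (f : Fin l → Coord k),
      (Matrix.of fun a b => B (f a) (f b)) = secondFFMatrix z x ν f := fun f => by
    ext a b
    exact hB _ _
  rw [hH, hH]
  set s : ℂ := -(Complex.I * (Real.tanh t : ℝ)) with hs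
  have h1 : ∑ d ∈ Finset.range (k + 1), s ^ d * (elemSymm (secondFFMatrix z x ν e) d : ℂ)
      = ∑ d ∈ Finset.range (k + 3), s ^ d * (elemSymm (secondFFMatrix z x ν e) d : ℂ) := by
    rw [Finset.sum_range_succ _ (k + 2), Finset.sum_range_succ _ (k + 1),
      elemSymm_eq_zero (show k < k + 1 by omega), elemSymm_eq_zero (show k < k + 2 by omega)]
    simp
  have h2 : ∑ d ∈ Finset.range (k + 1),
        s ^ (d + 2) * (elemSymm (secondFFMatrix z x ν ehat) d : ℂ)
      = ∑ d ∈ Finset.range (k + 3),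
        s ^ d * (elemSymm (secondFFMatrix z x ν ehat) ((d : ℤ) - 2) : ℂ) := by
    rw [Finset.sum_range_succ' _ (k + 2), Finset.sum_range_succ' _ (k + 1)]
    simp only [Nat.cast_add, Nat.cast_one, Nat.cast_zero, add_assoc]
    norm_num [elemSymm]
  rw [h1, h2, Finset.mul_sum, ← Finset.sum_sub_distrib]
  refine Finset.sum_congr rfl fun d _ => ?_
  simp only [phaseCoeff, ContinuousLinearMap.coe_coe]
  push_cast
  ring

lemma det_shapeMatrix_zero : (shapeMatrix z x 0 e).det = 1 := by
  have : shapeMatrix z x 0 e = 1 := by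
    ext a b
    simp [shapeMatrix, secondFF, coshSqrt_zero, sinhcSqrt_zero, J, Matrix.one_apply]
  rw [this, Matrix.det_one]

/-- Beyond the range of degrees in the theorem the odd coefficients vanish: if `J ν` has a
tangential part, then `Ĥ` has one eigenvalue less than `H`. -/
lemma phaseCoeff_eq_zero (he : IsONBasis z x (tangentSubspace z x) e)
    (he' : IsONBasis z x (tangentSubspace z x ⊓ (ℝ ∙ J ν)ᗮ) ehat) {j : ℕ} (hj : k / 2 < j) :
    phaseCoeff z x ν e ehat (2 * j + 1) = 0 := by
  have h2 : ((2 * j + 1 : ℕ) : ℤ) - 2 = ((2 * j - 1 : ℕ) : ℤ) := by omega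
  rw [phaseCoeff, elemSymm_eq_zero (show k < 2 * j + 1 by omega), h2]
  rcases card_adapted (L := (hderiv z x).toLinearMap) (η := J ν) he.1 he.2 he'.1 he'.2
    with ⟨h0, -⟩ | hm
  · have : ∑ a, ⟪hderiv z x (e a), J ν⟫_ℝ ^ 2 = 0 :=
      Finset.sum_eq_zero fun a _ => by rw [show ⟪hderiv z x (e a), J ν⟫_ℝ = 0 from h0 a]; simp
    rw [this]
    simp
  · rw [elemSymm_eq_zero (show m < 2 * j - 1 by omega)]
    simp

lemma phaseCoeff_eq_zero_iff (hν1 : ‖ν‖ = 1) (he : IsONBasis z x (tangentSubspace z x) e)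
    (j : ℕ) : phaseCoeff z x ν e ehat (2 * j + 1) = 0 ↔
      elemSymm (secondFFMatrix z x ν e) (2 * j + 1) =
        Real.cos (angleTo (J ν) (tangentSubspace z x)) ^ 2 *
          elemSymm (secondFFMatrix z x ν ehat) (2 * j - 1) := by
  rw [cos_angleTo_sq ((norm_J ν).trans hν1) he.1 he.2, phaseCoeff, sub_eq_zero]
  have h1 : ((2 * j + 1 : ℕ) : ℤ) = 2 * j + 1 := by push_cast; ring
  have h2 : ((2 * j + 1 : ℕ) : ℤ) - 2 = 2 * j - 1 := by push_cast; ring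
  rw [h2, h1]

/-- The determinant is real on the whole ray if the odd coefficients vanish. -/
lemma im_det_shapeMatrix_smul (h : IsUnitLift z x) (hν : IsNormal z x ν) (hν1 : ‖ν‖ = 1)
    (he : IsONBasis z x (tangentSubspace z x) e)
    (he' : IsONBasis z x (tangentSubspace z x ⊓ (ℝ ∙ J ν)ᗮ) ehat)
    (hc : ∀ j ≤ k / 2, phaseCoeff z x ν e ehat (2 * j + 1) = 0) (t : ℝ) :
    (shapeMatrix z x (t • ν) e).det.im = 0 := by
  rw [det_shapeMatrix_smul h hν hν1 he he', ← Complex.ofReal_pow, Complex.im_ofReal_mul,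
    Complex.im_sum, Finset.sum_eq_zero, mul_zero]
  intro d _
  rcases Nat.even_or_odd' d with ⟨j, rfl | rfl⟩
  · have : (-(Complex.I * (Real.tanh t : ℝ))) ^ (2 * j) = (((-Real.tanh t ^ 2) ^ j : ℝ) : ℂ) := by
      rw [pow_mul, neg_sq, mul_pow, Complex.I_sq]
      push_cast
      ring
    rw [this, ← Complex.ofReal_mul, Complex.ofReal_im]
  · rcases le_or_gt j (k / 2) with hj | hj
    · rw [hc j hj]; simp
    · rw [phaseCoeff_eq_zero he he' hj]; simp

end Coeff

/-! ### Independence of the lift and orthonormal bases -/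

/-- Two lifts differ by a unit complex function, so their horizontal derivatives have the same
kernel. -/
lemma IsLiftAt.injective_hderiv {M : Type*} [TopologicalSpace M] [ChartedSpace (Coord k) M]
    {F : M → Projectivization ℂ (Hom n)} {p : M} {z : Coord k → Hom n}
    (hF : IsSmoothImmersion k F) (hz : IsLiftAt F p z) :
    Function.Injective (hderiv z (chartPt k p)) := by
  obtain ⟨z₀, hz₀, hinj⟩ := hF p
  have h := hz.isUnitLift
  have h₀ := hz₀.isUnitLift
  have hev : z₀ =ᶠ[𝓝 (chartPt k p)] fun y => ⟪z y, z₀ y⟫_ℂ • z y := by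
    obtain ⟨U, hU, hx, -, hn⟩ := hz
    obtain ⟨U₀, hU₀, hx₀, -, hn₀⟩ := hz₀
    filter_upwards [hU.mem_nhds hx, hU₀.mem_nhds hx₀] with y hy hy₀
    obtain ⟨h1, h2⟩ := hn y hy
    have h3 := (hn₀ y hy₀).2
    have hne : z y ≠ 0 := norm_ne_zero_iff.1 (h1.trans_ne one_ne_zero)
    have hspan : (F ((extChartAt (𝓡 k) p).symm y)).submodule = ℂ ∙ z y := by
      refine (Submodule.eq_of_le_of_finrank_eq
        ((Submodule.span_singleton_le_iff_mem _ _).2 h2) ?_).symm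
      rw [finrank_span_singleton hne, Projectivization.finrank_submodule]
    rw [hspan] at h3
    obtain ⟨c, hc⟩ := Submodule.mem_span_singleton.1 h3
    rw [← hc, inner_smul_right, inner_self_eq_norm_sq_to_K, h1]
    simp
  have hx := hev.self_of_nhds
  set c : ℂ := ⟪z (chartPt k p), z₀ (chartPt k p)⟫_ℂ with hc
  have hd : fderiv ℝ z₀ (chartPt k p) = fderiv ℝ (fun y => ⟪z y, z₀ y⟫_ℂ • z y) (chartPt k p) :=
    hev.fderiv_eq
  have hg : DifferentiableAt ℝ (fun y => ⟪z y, z₀ y⟫_ℂ) (chartPt k p) :=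
    h.differentiableAt.inner ℂ h₀.differentiableAt
  have hkey : ∀ u, hderiv z₀ (chartPt k p) u = c • hderiv z (chartPt k p) u := by
    intro u
    have h1 : fderiv ℝ z₀ (chartPt k p) u = c • fderiv ℝ z (chartPt k p) u
        + (fderiv ℝ (fun y => ⟪z y, z₀ y⟫_ℂ) (chartPt k p) u) • z (chartPt k p) := by
      rw [hd, fderiv_fun_smul hg h.differentiableAt]
      rfl
    have hcc : (starRingEnd ℂ) c * c = 1 := by
      have := congrArg norm hx
      rw [norm_smul, h.norm_self, h₀.norm_self, mul_one] at this
      rw [mul_comm, Complex.mul_conj, Complex.normSq_eq_norm_sq, ← this]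
      simp
    have hzz : ⟪z (chartPt k p), z (chartPt k p)⟫_ℂ = 1 := by
      rw [inner_self_eq_norm_sq_to_K, h.norm_self]
      simp
    rw [IsUnitLift.hderiv_apply h₀.norm_self, IsUnitLift.hderiv_apply h.norm_self, h1, hx,
      inner_smul_left, inner_add_right, inner_smul_right, inner_smul_right, hzz, smul_smul]
    generalize ⟪z (chartPt k p), fderiv ℝ z (chartPt k p) u⟫_ℂ = a
    generalize fderiv ℝ (fun y => ⟪z y, z₀ y⟫_ℂ) (chartPt k p) u = b
    rw [show (starRingEnd ℂ) c * (c * a + b * 1) * c = c * a + b by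
      linear_combination (c * a + b) * hcc]
    module
  intro u v huv
  apply hinj
  rw [hkey, hkey, huv]

lemma exists_isONBasis {z : Coord k → Hom n} {x : Coord k} {W : Submodule ℝ (Hom n)}
    (hW : W ≤ tangentSubspace z x) :
    ∃ e : Fin (Module.finrank ℝ W) → Coord k, IsONBasis z x W e := by
  set b := stdOrthonormalBasis ℝ W
  choose e he using fun a => hW (b a).2
  have he : (fun a => hderiv z x (e a)) = fun a => (b a : Hom n) := funext he
  refine ⟨e, ?_, ?_⟩
  · rw [he]
    exact b.orthonormal.comp_linearIsometry W.subtypeₗᵢ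
  · have h1 : (Set.range fun a => (b a : Hom n)) = W.subtype '' Set.range b.toBasis := by
      rw [b.coe_toBasis, ← Set.range_comp]
      rfl
    rw [he, h1, ← Submodule.map_span, b.toBasis.span_eq, Submodule.map_subtype_top]

lemma exists_isONBasis_tangentSubspace {z : Coord k → Hom n} {x : Coord k}
    (hinj : Function.Injective (hderiv z x)) :
    ∃ e : Fin k → Coord k, IsONBasis z x (tangentSubspace z x) e := by
  have h1 : Module.finrank ℝ (tangentSubspace z x) = k := by
    rw [tangentSubspace, LinearMap.finrank_range_of_inj hinj, finrank_euclideanSpace_fin]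
  have h2 := exists_isONBasis (le_refl (tangentSubspace z x))
  rwa [h1] at h2

lemma IsNormal.smul {z : Coord k → Hom n} {x : Coord k} {ν : Hom n} (hν : IsNormal z x ν) (t : ℝ) :
    IsNormal z x (t • ν) := by
  refine ⟨?_, fun X hX => ?_⟩
  · rw [inner_smul_right_eq_smul, hν.1, smul_zero]
  · rw [real_inner_smul_right, hν.2 X hX, mul_zero]

end

end CPAustere

end

open CPAustere in
theorem theorem1 {n k : ℕ} {M : Type*} [TopologicalSpace M]
    [ChartedSpace (EuclideanSpace ℝ (Fin k)) M] [IsManifold (𝓡 k) ∞ M]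
    (F : M → Projectivization ℂ (EuclideanSpace ℂ (Fin (n + 1))))
    (hF : CPAustere.IsSmoothImmersion k F) :
    CPAustere.IsAustere k F ↔
      ∀ (p : M) (z : EuclideanSpace ℝ (Fin k) → EuclideanSpace ℂ (Fin (n + 1))),
        CPAustere.IsLiftAt F p z →
        ∀ ν : EuclideanSpace ℂ (Fin (n + 1)),
          CPAustere.IsNormal z (CPAustere.chartPt k p) ν → ‖ν‖ = 1 →
          ∀ (e : Fin k → EuclideanSpace ℝ (Fin k)) (m : ℕ)
            (ehat : Fin m → EuclideanSpace ℝ (Fin k)),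
            CPAustere.IsONBasis z (CPAustere.chartPt k p)
              (CPAustere.tangentSubspace z (CPAustere.chartPt k p)) e →
            CPAustere.IsONBasis z (CPAustere.chartPt k p)
              (CPAustere.tangentSubspace z (CPAustere.chartPt k p) ⊓ (ℝ ∙ CPAustere.J ν)ᗮ) ehat →
            ∀ j : ℕ, j ≤ k / 2 →
              CPAustere.elemSymm
                  (CPAustere.secondFFMatrix z (CPAustere.chartPt k p) ν e) (2 * j + 1) =
                Real.cos (CPAustere.angleTo (CPAustere.J ν)
                    (CPAustere.tangentSubspace z (CPAustere.chartPt k p))) ^ 2 *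
                  CPAustere.elemSymm
                    (CPAustere.secondFFMatrix z (CPAustere.chartPt k p) ν ehat) (2 * j - 1) := by
  obtain ⟨κ, hκ, hvol⟩ := exists_holVol_phase n k
  have hκ0 : κ ≠ 0 := norm_ne_zero_iff.1 (hκ.trans_ne one_ne_zero)
  constructor
  · rintro ⟨φ, hφ⟩ p z hz ν hν hν1 e m ehat he he' j hj
    rw [← phaseCoeff_eq_zero_iff hν1 he j]
    refine odd_coeff_eq_zero_of_im_eq_zero (N := k + 3) phaseCoeff_zero (by omega)
      (mul_ne_zero (Complex.exp_ne_zero (φ * Complex.I)) hκ0) ?_ j (by omega)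
    intro τ hτ0 hτ1
    -- Test the condition at the normal vector `t ν` with `tanh t = τ`.
    set t : ℝ := Real.artanh τ with ht
    have hτ : Real.tanh t = τ := Real.tanh_artanh ⟨by linarith, hτ1⟩
    have ht0 : t ≠ 0 := by
      rintro h0
      rw [h0, Real.tanh_zero] at hτ
      exact hτ0.ne hτ
    have hν0 : t • ν ≠ 0 := smul_ne_zero ht0 (norm_ne_zero_iff.1 (hν1.trans_ne one_ne_zero))
    obtain ⟨v, hv, ρ, hρ, hveq⟩ := (hvol z _ (t • ν) e hz.isUnitLift he.1 (hν.smul t)).2 hν0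
    have h1 := (hφ p z hz (t • ν) (hν.smul t)).2 v hv
    rw [hveq, det_shapeMatrix_smul hz.isUnitLift hν hν1 he he', hτ] at h1
    set S : ℂ := ∑ d ∈ Finset.range (k + 3), (-(Complex.I * (τ : ℝ))) ^ d
        * (phaseCoeff z (chartPt k p) ν e ehat d : ℂ) with hS
    have h2 : Complex.exp (φ * Complex.I) * (ρ * (κ * ((Real.cosh t : ℂ) ^ k * S)))
        = ((ρ * Real.cosh t ^ k : ℝ) : ℂ) * (Complex.exp (φ * Complex.I) * κ * S) := by
      push_cast
      ring
    rw [h2, Complex.im_ofReal_mul] at h1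
    exact (mul_eq_zero.1 h1).resolve_left
      (mul_ne_zero hρ (pow_ne_zero _ (Real.cosh_pos t).ne'))
  · intro H
    -- The phase which cancels the universal constant `κ`.
    refine ⟨-κ.arg, fun p z hz ν hν => ?_⟩
    have hinj := hz.injective_hderiv hF
    refine ⟨fun u v hu hv => stenzelForm_eq_zero hz.isUnitLift hinj hν hu hv, fun v hv => ?_⟩
    obtain ⟨e, he⟩ := exists_isONBasis_tangentSubspace hinj
    obtain ⟨ρ, hρ⟩ := (hvol z _ ν e hz.isUnitLift he.1 hν).1 v hv
    have hphase : Complex.exp ((-κ.arg : ℝ) * Complex.I) * κ = 1 := by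
      have h1 := Complex.norm_mul_exp_arg_mul_I κ
      rw [hκ, Complex.ofReal_one, one_mul] at h1
      nth_rw 2 [← h1]
      rw [← Complex.exp_add]
      simp
    have hdet : (shapeMatrix z (chartPt k p) ν e).det.im = 0 := by
      rcases eq_or_ne ν 0 with rfl | hν0
      · rw [det_shapeMatrix_zero, Complex.one_im]
      · have hν1 : ‖(‖ν‖⁻¹ • ν)‖ = 1 := by
          rw [norm_smul, norm_inv, norm_norm, inv_mul_cancel₀ (norm_ne_zero_iff.2 hν0)]
        obtain ⟨ehat, he'⟩ := exists_isONBasis (z := z) (x := chartPt k p)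
          (inf_le_left : tangentSubspace z (chartPt k p) ⊓ (ℝ ∙ J (‖ν‖⁻¹ • ν))ᗮ ≤ _)
        have := im_det_shapeMatrix_smul hz.isUnitLift (hν.smul ‖ν‖⁻¹) hν1 he he'
          (fun j hj => (phaseCoeff_eq_zero_iff hν1 he j).2
            (H p z hz _ (hν.smul _) hν1 e _ ehat he he' j hj)) ‖ν‖
        rwa [smul_smul, mul_inv_cancel₀ (norm_ne_zero_iff.2 hν0), one_smul] at this
    rw [hρ, mul_left_comm, ← mul_assoc (Complex.exp _), hphase, one_mul, Complex.im_ofReal_mul,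
      hdet, mul_zero]
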